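/- Let $I$ be a finite set of Boolean situation-variables and $A$ a finite set of actions. A *requirement* is a pair $(s,a)$ of a truth assignment $s$ to $I$ and an action $a\in A$. A *condition* is a variable of $I$ or its negation. A *procedure* is a statement "if $c_1$ then $a_1$ elsif $\dots$ elsif $c_m$ then $a_m$ else $a$" with $m\ge 0$ conditions and actions from $A$ (for $m=0$ a single action). A *selector* is a statement "if $c_1$ then ??? elsif $\dots$ elsif $c_k$ then ??? else ???" with $k\ge 0$ conditions and $k+1$ blank procedure slots (for $k=0$ it is the default selector "if $*$ then ???"). A *system* is a selector together with a procedure in each of its slots; it *satisfies* a set $R$ of requirements if for each $(s,a)\in R$ its execution under $s$ executes $a$. Let $L_{sel}$ and $L_{prc}$ be finite sets (libraries) of selectors and procedures. A system is *drawn from* the libraries if its selector is in $L_{sel}$ and all its procedures are in $L_{prc}$. Its number of *component types* is one (for the selector) plus the number of distinct procedures in its slots. A *component change* either replaces the selector by a different one from $L_{sel}$ with the same number of conditions, each slot keeping its procedure, or replaces the procedure in one slot by another one from $L_{prc}$. **SCre-Comp.** Input: $I$, $A$, a finite set $R$ of requirements, $L_{sel}$, $L_{prc}$, and an integer $d\ge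 0$. Output: a system drawn from the libraries with at most $d$ component types that satisfies $R$, if one exists, and $\bot$ otherwise. **SRec-Comp.** Input: $I$, $A$, $R$, $L_{sel}$, $L_{prc}$ as above, a system $S$ drawn from the libraries that satisfies $R$, a finite set $R_{new}$ of requirements, and integers $c_l,d\ge 0$. Output: a system that is obtained from $S$ by at most $c_l$ component changes, has at most $d$ component types and satisfies $R\cup R_{new}$, if one exists, and $\bot$ otherwise. Let $|sel|$ be the maximum number of conditions of a selector in $L_{sel}$. Then SCre-Comp and SRec-Comp are fixed-parameter tractable when parameterized jointly by $|sel|$ and $|L_{prc}|$: for each of the two problems there are a deterministic algorithm that solves it, a function $f$ and a constant $c$ such that on every input of size $n$ (with numbers written in binary) the running time is at most $f(|sel|,|L_{prc}|)\cdot n^{c}$. -/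

import Mathlib

namespace CompSoft

/-! ### Computational model: `WHILE`-programs over cons cells

Data are finite binary trees. A program is a finite text that works on finitely many registers, each
holding one tree, with the elementary operations of a list machine (`nil`, `cons`, head, tail, copy), a
test for the empty tree, and loops. -/

/-- Finite binary trees (S-expressions over the single atom `nil`). -/
inductive Cell : Type where
  | nil : Cell
  | cons : Cell → Cell → Cell

namespace Cell

/-- The size of a tree: the number of its nodes, leaves included. -/
def size : Cell → ℕ
  | nil => 1
  | cons a b => a.size + b.size + 1

/-- The first component (`nil` has first component `nil`). -/
def head : Cell → Cell
  | nil => nil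
  | cons a _ => a

/-- The second component (`nil` has second component `nil`). -/
def tail : Cell → Cell
  | nil => nil
  | cons _ b => b

end Cell

/-- Programs. Registers are named by natural numbers; a program mentions finitely many of them. -/
inductive Prog : Type where
  /-- `x := nil` -/
  | setNil (x : ℕ) : Prog
  /-- `x := y` -/
  | copy (x y : ℕ) : Prog
  /-- `x := cons y z` -/
  | setCons (x y z : ℕ) : Prog
  /-- `x := head y` -/
  | setHead (x y : ℕ) : Prog
  /-- `x := tail y` -/
  | setTail (x y : ℕ) : Prog
  /-- `p; q` -/
  | seq (p q : Prog) : Prog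
  /-- `if x ≠ nil then p else q` -/
  | ite (x : ℕ) (p q : Prog) : Prog
  /-- `while x ≠ nil do p` -/
  | loop (x : ℕ) (p : Prog) : Prog

/-- The contents of the registers. -/
abbrev Store : Type := ℕ → Cell

/-- `Exec p σ τ t`: started in the store `σ`, the program `p` halts in the store `τ` after time `t`.

Every test and every assignment costs one unit, except that building a new tree with `cons` costs the
whole size of the tree that is built. So no register ever holds a tree larger than the
input plus the elapsed time, and the model agrees with Turing machines up to polynomial factors. -/
inductive Exec : Prog → Store → Store → ℕ → Prop where
  | setNil (x : ℕ) (σ : Store) :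
      Exec (.setNil x) σ (Function.update σ x .nil) 1
  | copy (x y : ℕ) (σ : Store) :
      Exec (.copy x y) σ (Function.update σ x (σ y)) 1
  | setCons (x y z : ℕ) (σ : Store) :
      Exec (.setCons x y z) σ (Function.update σ x (.cons (σ y) (σ z))) (Cell.cons (σ y) (σ z)).size
  | setHead (x y : ℕ) (σ : Store) :
      Exec (.setHead x y) σ (Function.update σ x (σ y).head) 1
  | setTail (x y : ℕ) (σ : Store) :
      Exec (.setTail x y) σ (Function.update σ x (σ y).tail) 1
  | seq {p q : Prog} {σ τ ρ : Store} {t u : ℕ} :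
      Exec p σ τ t → Exec q τ ρ u → Exec (.seq p q) σ ρ (t + u)
  | ite_then {x : ℕ} {p q : Prog} {σ τ : Store} {t : ℕ} :
      σ x ≠ .nil → Exec p σ τ t → Exec (.ite x p q) σ τ (t + 1)
  | ite_else {x : ℕ} {p q : Prog} {σ τ : Store} {t : ℕ} :
      σ x = .nil → Exec q σ τ t → Exec (.ite x p q) σ τ (t + 1)
  | loop_stop {x : ℕ} {p : Prog} {σ : Store} :
      σ x = .nil → Exec (.loop x p) σ σ 1
  | loop_step {x : ℕ} {p : Prog} {σ τ ρ : Store} {t u : ℕ} :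
      σ x ≠ .nil → Exec p σ τ t → Exec (.loop x p) τ ρ u → Exec (.loop x p) σ ρ (t + u + 1)

/-- The initial store: the input stands in register `0`, all other registers hold `nil`. -/
def initStore (input : Cell) : Store := Function.update (fun _ => Cell.nil) 0 input

/-- On input `input`, the program `p` halts after time `t` with `output` in register `0`. -/
def Prog.Computes (p : Prog) (input output : Cell) (t : ℕ) : Prop :=
  ∃ τ : Store, Exec p (initStore input) τ t ∧ τ 0 = output

/-! ### Encodings of finite objects as trees -/

def encBool : Bool → Cell
  | false => .nil
  | true => .cons .nil .nil

def encList {α : Type} (enc : α → Cell) : List α → Cell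
  | [] => .nil
  | a :: l => .cons (enc a) (encList enc l)

/-- Natural numbers are written in binary. -/
def encNat (n : ℕ) : Cell := encList encBool n.bits

def encOption {α : Type} (enc : α → Cell) : Option α → Cell
  | none => .nil
  | some a => .cons (enc a) .nil

/-! ### Parameterized search problems and fixed-parameter tractability -/

/-- A search problem with `m` numerical parameters: for an instance `x`, find a `y : Sol x` with
`IsSol x y`, or report that there is none. -/
structure ParamProblem (m : ℕ) where
  Inst : Type
  Sol : Inst → Type
  IsSol : (x : Inst) → Sol x → Prop
  encInst : Inst → Cell
  encSol : (x : Inst) → Sol x → Cell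
  param : Inst → Fin m → ℕ

/-- `y` is a correct answer on the instance `x`: a solution if there is one,
and `none` (the special symbol `⊥`) otherwise. -/
def ParamProblem.IsAnswer {m : ℕ} (P : ParamProblem m) (x : P.Inst) : Option (P.Sol x) → Prop
  | some y => P.IsSol x y
  | none => ∀ y : P.Sol x, ¬ P.IsSol x y

/-- Fixed-parameter tractability: a single algorithm gives a correct answer on every instance, in time
at most `f K * n ^ c`, where `K` is the tuple of parameter values and `n` the size of the input. -/
def ParamProblem.FPTractable {m : ℕ} (P : ParamProblem m) : Prop :=
  ∃ (p : Prog) (f : (Fin m → ℕ) → ℕ) (c : ℕ), ∀ x : P.Inst,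
    ∃ (y : Option (P.Sol x)) (t : ℕ),
      P.IsAnswer x y ∧
      p.Computes (P.encInst x) (encOption (P.encSol x) y) t ∧
      t ≤ f (P.param x) * (P.encInst x).size ^ c

/-! ### Two-level software systems

The situation-variables are `Fin nI`, the actions are `Fin nA`. -/

/-- A situation: a truth-value for each situation-variable. -/
abbrev Situation (nI : ℕ) : Type := Fin nI → Bool

/-- A requirement: a situation together with the action wanted in it. -/
abbrev Requirement (nI nA : ℕ) : Type := Situation nI × Fin nA

/-- A condition of an `IF-THEN` statement: a situation-variable (`positive = true`) or
its negation (`positive = false`). -/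
structure Cond (nI : ℕ) where
  var : Fin nI
  positive : Bool

/-- The condition evaluates to true in the situation `s`. -/
def Cond.holds {nI : ℕ} (c : Cond nI) (s : Situation nI) : Bool := s c.var == c.positive

/-- A selector with blank procedure calls, given by the list of its conditions:
`if c₁ then ??? elsif c₂ then ??? … else ???`. The empty list is the default selector
`if * then ???`. A selector with `k` conditions has `k + 1` procedure slots. -/
abbrev Selector (nI : ℕ) : Type := List (Cond nI)

/-- A procedure `if c₁ then a₁ elsif c₂ then a₂ … else a`. With no branches it is
the single action `a`. -/
structure Procedure (nI nA : ℕ) where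
  branches : List (Cond nI × Fin nA)
  final : Fin nA

/-- The action that the procedure executes in the situation `s`: that of the first branch whose
condition holds, and the final one if there is none. -/
def Procedure.exec {nI nA : ℕ} (p : Procedure nI nA) (s : Situation nI) : Fin nA :=
  match p.branches.find? (fun b => b.1.holds s) with
  | some b => b.2
  | none => p.final

/-- A two-level software system: a selector and a procedure for each of its slots, in order
(the last one is called by the final `ELSE`). -/
structure System (nI nA : ℕ) where
  sel : Selector nI
  prcs : List (Procedure nI nA)
  length_prcs : prcs.length = sel.length + 1

namespace System

variable {nI nA : ℕ}

/-- The number of the slot that is called in the situation `s`: the first one whose condition holds,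
and the last slot if there is none. -/
def slot (S : System nI nA) (s : Situation nI) : Fin S.prcs.length :=
  ⟨S.sel.findIdx (fun c => c.holds s), by
    have h : S.sel.findIdx (fun c => c.holds s) ≤ S.sel.length := List.findIdx_le_length
    have h' := S.length_prcs
    omega⟩

/-- The action that the system executes in the situation `s`. -/
def exec (S : System nI nA) (s : Situation nI) : Fin nA := (S.prcs.get (S.slot s)).exec s

/-- The operation of the system satisfies the requirements `R`. -/
def Satisfies (S : System nI nA) (R : List (Requirement nI nA)) : Prop :=
  ∀ r ∈ R, S.exec r.1 = r.2

/-- The number of types of components of the system: its selector, and the distinct procedures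
among those it calls. -/
noncomputable def numTypes (S : System nI nA) : ℕ := 1 + {p | p ∈ S.prcs}.ncard

end System

/-- A selector library and a procedure library (both are sets, listed without repetition). -/
structure Libraries (nI nA : ℕ) where
  sel : List (Selector nI)
  prc : List (Procedure nI nA)
  sel_nodup : sel.Nodup
  prc_nodup : prc.Nodup

/-- The maximum number of conditions in a selector of the library. -/
def Libraries.maxConds {nI nA : ℕ} (L : Libraries nI nA) : ℕ := (L.sel.map List.length).foldr max 0

/-- The system is constructed from components drawn from the libraries `L`. -/
def System.DrawnFrom {nI nA : ℕ} (S : System nI nA) (L : Libraries nI nA) : Prop :=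
  S.sel ∈ L.sel ∧ ∀ p ∈ S.prcs, p ∈ L.prc

/-- A single component change relative to the libraries `L`. -/
inductive Change {nI nA : ℕ} (L : Libraries nI nA) : System nI nA → System nI nA → Prop where
  /-- The selector is replaced by a different one from the library with the same number of conditions;
  the called procedures keep their positions. -/
  | sel {S S' : System nI nA} : S'.sel ∈ L.sel → S'.sel ≠ S.sel → S'.sel.length = S.sel.length →
      S'.prcs = S.prcs → Change L S S'
  /-- The procedure called in one slot is replaced by another one from the library. -/
  | prc {S S' : System nI nA} (i : Fin S.prcs.length) (p : Procedure nI nA) : p ∈ L.prc →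
      p ≠ S.prcs.get i → S'.sel = S.sel → S'.prcs = S.prcs.set i p → Change L S S'

/-- `S'` arises from `S` by a sequence of exactly `k` component changes. -/
inductive DerivedIn {nI nA : ℕ} (L : Libraries nI nA) (S : System nI nA) :
    ℕ → System nI nA → Prop where
  | refl : DerivedIn L S 0 S
  | step {k : ℕ} {S' S'' : System nI nA} : DerivedIn L S k S' → Change L S' S'' →
      DerivedIn L S (k + 1) S''

/-! ### Encodings of requirements, components, libraries and systems -/

section Encodings

variable {nI nA : ℕ}

def encSituation (s : Situation nI) : Cell := encList encBool (List.ofFn s)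

def encRequirement (r : Requirement nI nA) : Cell := .cons (encSituation r.1) (encNat r.2)

def encCond (c : Cond nI) : Cell := .cons (encNat c.var) (encBool c.positive)

def encSelector (l : Selector nI) : Cell := encList encCond l

def encProcedure (p : Procedure nI nA) : Cell :=
  .cons (encList (fun b => .cons (encCond b.1) (encNat b.2)) p.branches) (encNat p.final)

def encSystem (S : System nI nA) : Cell := .cons (encSelector S.sel) (encList encProcedure S.prcs)

def encLibraries (L : Libraries nI nA) : Cell :=
  .cons (encList encSelector L.sel) (encList encProcedure L.prc)

end Encodings

/-! ### Software Creation from Components -/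

/-- An instance: situation-variables, actions, requirements, libraries, and the bound `d`. -/
structure CreInstance where
  nI : ℕ
  nA : ℕ
  R : List (Requirement nI nA)
  L : Libraries nI nA
  d : ℕ

def encCreInstance (x : CreInstance) : Cell :=
  .cons (encNat x.nI) (.cons (encNat x.nA)
    (.cons (encList encRequirement x.R) (.cons (encLibraries x.L) (encNat x.d))))

/-- Software Creation from Components, parameterized by the maximum number of selector conditions and
the number of procedures in the procedure library. -/
def SCreComp : ParamProblem 2 where
  Inst := CreInstance
  Sol x := System x.nI x.nA
  IsSol x S := S.DrawnFrom x.L ∧ S.numTypes ≤ x.d ∧ S.Satisfies x.R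
  encInst := encCreInstance
  encSol _ S := encSystem S
  param x := ![x.L.maxConds, x.L.prc.length]

/-! ### Software Reconfiguration from Components -/

/-- An instance: situation-variables, actions, requirements, libraries, a system `S` that is constructed
from the libraries and satisfies the requirements, new requirements, and the bounds `cl` and `d`. -/
structure RecInstance where
  nI : ℕ
  nA : ℕ
  R : List (Requirement nI nA)
  L : Libraries nI nA
  S : System nI nA
  drawnFrom : S.DrawnFrom L
  satisfies : S.Satisfies R
  Rnew : List (Requirement nI nA)
  cl : ℕ
  d : ℕ

def encRecInstance (x : RecInstance) : Cell :=
  .cons (encNat x.nI) (.cons (encNat x.nA)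
    (.cons (encList encRequirement x.R) (.cons (encLibraries x.L)
      (.cons (encSystem x.S) (.cons (encList encRequirement x.Rnew)
        (.cons (encNat x.cl) (encNat x.d)))))))

/-- Software Reconfiguration from Components, parameterized by the maximum number of selector conditions
and the number of procedures in the procedure library. -/
def SRecComp : ParamProblem 2 where
  Inst := RecInstance
  Sol x := System x.nI x.nA
  IsSol x S' := (∃ k ≤ x.cl, DerivedIn x.L x.S k S') ∧ S'.numTypes ≤ x.d ∧
    S'.Satisfies (x.R ++ x.Rnew)
  encInst := encRecInstance
  encSol _ S := encSystem S
  param x := ![x.L.maxConds, x.L.prc.length]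

end CompSoft

namespace CompSoft

/-! ### Polynomial bounds -/

/-! Both problems are solved by exhaustive search. A selector with `k` conditions can be filled from
the procedure library in `|L_prc| ^ (k + 1)` ways (`length_tuples`), so at most `|L_sel| * (|L_prc|
+ 1) ^ (|sel| + 1)` systems have to be tried (`mem_candidates`), and each is tested in polynomial
time. For reconfiguration, reachability by at most `c_l` changes must first be made testable. Slots
can be changed independently, and one selector change reaches any other library selector with
equally many conditions. Hence the least number of changes is the number of differing slots, plus
one if the selectors differ (`exists_derivedIn_iff`).

The rest is to carry out this search in the machine model. `PolyTime` is closed under composition,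
pairing, branching and folds (`PolyTime.foldl`), and `fun_prop` assembles programs from these
closure properties. Its time bound is fixed before the registers, so scratch registers can be
allocated freely. The factor that depends on the parameters is hidden in a weight: `Weighted` adds
the bound on the number of fillings to the input size, which makes the candidate list computable in
time polynomial in the weight (`PolyTime.candidates`). `ParamProblem.fpTractable_of_polyTime` then
splits a power of the sum `n + g` into a parameter part and an input part.

A single program cannot depend on the types `Fin nI` and `Fin nA` of an instance. The search
therefore runs on untyped copies with the same codes, and `exists_answer` lifts its result back to
typed systems. -/

/-- `f` is bounded by a polynomial in `w`. -/
def PolyBdd {α : Type} (w f : α → ℕ) : Prop := ∃ k, ∀ a, f a ≤ (w a + 2) ^ k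

namespace PolyBdd

variable {α β : Type} {w f g : α → ℕ}

theorem pow_mono (n : ℕ) {k l : ℕ} (h : k ≤ l) : (n + 2) ^ k ≤ (n + 2) ^ l :=
  Nat.pow_le_pow_right (by omega) h

theorem mono (hg : PolyBdd w g) (h : ∀ a, f a ≤ g a) : PolyBdd w f :=
  hg.imp fun _ hk a => (h a).trans (hk a)

theorem self : PolyBdd w w := ⟨1, fun a => by simp⟩

theorem const (c : ℕ) : PolyBdd w (fun _ => c) :=
  ⟨c, fun a => (Nat.lt_two_pow_self).le.trans (Nat.pow_le_pow_left (by omega) c)⟩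

theorem mul (hf : PolyBdd w f) (hg : PolyBdd w g) : PolyBdd w (fun a => f a * g a) := by
  obtain ⟨k, hk⟩ := hf
  obtain ⟨l, hl⟩ := hg
  exact ⟨k + l, fun a => by rw [pow_add]; exact Nat.mul_le_mul (hk a) (hl a)⟩

theorem add (hf : PolyBdd w f) (hg : PolyBdd w g) : PolyBdd w (fun a => f a + g a) := by
  obtain ⟨k, hk⟩ := hf
  obtain ⟨l, hl⟩ := hg
  refine ⟨k + l + 1, fun a => ?_⟩
  have h1 := (hk a).trans (pow_mono (w a) (show k ≤ k + l by omega))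
  have h2 := (hl a).trans (pow_mono (w a) (show l ≤ k + l by omega))
  calc f a + g a ≤ (w a + 2) ^ (k + l) * 2 := by omega
    _ ≤ (w a + 2) ^ (k + l) * (w a + 2) := Nat.mul_le_mul_left _ (by omega)
    _ = _ := (pow_succ _ _).symm

/-- A polynomial in a polynomial is a polynomial; here `v` measures the intermediate value and `w`
the original argument. -/
theorem comp {v h : β → ℕ} {F : α → β} (hh : PolyBdd v h) (hF : PolyBdd w (fun a => v (F a))) :
    PolyBdd w (fun a => h (F a)) := by
  obtain ⟨k, hk⟩ := hh
  obtain ⟨l, hl⟩ := hF.add (const 2)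
  exact ⟨l * k, fun a => (hk _).trans (by rw [pow_mul]; exact Nat.pow_le_pow_left (hl a) k)⟩

theorem pow (hf : PolyBdd w f) (k : ℕ) : PolyBdd w (fun a => f a ^ k) := by
  obtain ⟨l, hl⟩ := hf
  exact ⟨l * k, fun a => by rw [pow_mul]; exact Nat.pow_le_pow_left (hl a) k⟩

end PolyBdd

/-! ### Encoded types and polynomial-time functions -/

/-- A type with an encoding by trees. The weight of an element is at least the size of its code;
running times are measured in terms of the weight. -/
class Code (α : Type) where
  enc : α → Cell
  wt : α → ℕ
  size_le : ∀ a, (enc a).size ≤ wt a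

open Code

theorem Cell.size_pos (c : Cell) : 0 < c.size := by cases c <;> simp [Cell.size]

namespace Code

instance : Code Cell := ⟨id, Cell.size, fun _ => le_rfl⟩

instance : Code Bool := ⟨encBool, fun b => (encBool b).size, fun _ => le_rfl⟩

instance : Code ℕ := ⟨encNat, fun b => (encNat b).size, fun _ => le_rfl⟩

instance {α β : Type} [Code α] [Code β] : Code (α × β) where
  enc z := .cons (enc z.1) (enc z.2)
  wt z := wt z.1 + wt z.2 + 1
  size_le z := by
    have := size_le z.1
    have := size_le z.2
    simp only [Cell.size]
    omega

/-- Subtypes let a time bound be claimed only for arguments that satisfy a side condition, at no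
cost in the code. -/
instance {α : Type} [Code α] (p : α → Prop) : Code {a // p a} where
  enc z := enc z.1
  wt z := wt z.1
  size_le z := size_le z.1

theorem size_encList_le {α : Type} [Code α] (l : List α) :
    (encList enc l).size ≤ (l.map fun a => wt a + 1).sum + 1 := by
  induction l with
  | nil => simp [encList, Cell.size]
  | cons a l ih =>
    have := size_le a
    simp only [encList, Cell.size, List.map_cons, List.sum_cons]
    omega

instance {α : Type} [Code α] : Code (List α) where
  enc := encList enc
  wt l := (l.map fun a => wt a + 1).sum + 1
  size_le := size_encList_le

instance {α : Type} [Code α] : Code (Option α) where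
  enc := encOption enc
  wt o := o.elim 1 fun a => wt a + 2
  size_le o := by
    cases o with
    | none => simp [encOption, Cell.size]
    | some a => simpa [encOption, Cell.size] using size_le a

variable {α β : Type} [Code α] [Code β]

theorem wt_pos (a : α) : 0 < wt a := (Cell.size_pos _).trans_le (size_le a)

theorem wt_prod (z : α × β) : wt z = wt z.1 + wt z.2 + 1 := rfl

@[simp] theorem wt_nil : wt ([] : List α) = 1 := rfl

@[simp] theorem wt_cons (a : α) (l : List α) : wt (a :: l) = wt a + wt l + 1 := by
  simp only [wt, List.map_cons, List.sum_cons]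
  omega

theorem wt_append (l m : List α) : wt (l ++ m) + 1 = wt l + wt m := by
  induction l with
  | nil => simp [add_comm]
  | cons a l ih => simp only [List.cons_append, wt_cons]; omega

theorem wt_reverse (l : List α) : wt l.reverse = wt l := by
  simp only [wt, List.map_reverse, List.sum_reverse]

theorem wt_sublist {l m : List α} (h : l.Sublist m) : wt l ≤ wt m := by
  induction h with
  | slnil => rfl
  | cons a _ ih => rw [wt_cons]; omega
  | cons_cons a _ ih => rw [wt_cons, wt_cons]; omega

theorem length_lt_wt (l : List α) : l.length < wt l := by
  induction l with
  | nil => simp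
  | cons a l ih => simp only [List.length_cons, wt_cons]; omega

theorem wt_lt_of_mem {a : α} {l : List α} (h : a ∈ l) : wt a < wt l := by
  induction l with
  | nil => simp at h
  | cons b l ih =>
    rw [wt_cons]
    rcases List.mem_cons.1 h with rfl | h
    · omega
    · have := ih h; omega

theorem wt_le_of_forall {l : List α} {B : ℕ} (h : ∀ a ∈ l, wt a ≤ B) :
    wt l ≤ l.length * (B + 1) + 1 := by
  induction l with
  | nil => simp
  | cons a l ih =>
    have h1 := ih fun b hb => h b (List.mem_cons_of_mem _ hb)
    have h2 := h a List.mem_cons_self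
    rw [wt_cons, List.length_cons, add_mul]
    omega

end Code

/-- The program `p` computes `f` from register `i` into register `o` in time `T`, and preserves the
other registers below `b`. -/
def Realizes {α β : Type} [Code α] [Code β] (p : Prog) (f : α → β) (T : α → ℕ) (b i o : ℕ) : Prop :=
  ∀ (a : α) (σ : Store), σ i = enc a → ∃ (τ : Store) (t : ℕ), t ≤ T a ∧ Exec p σ τ t ∧
    τ o = enc (f a) ∧ ∀ y < b, y ≠ o → τ y = σ y

/-- Functions computable in time polynomial in the weight of the argument. -/
@[fun_prop]
def PolyTime {α β : Type} [Code α] [Code β] (f : α → β) : Prop :=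
  PolyBdd wt (fun a => wt (f a)) ∧
    ∃ T : α → ℕ, PolyBdd wt T ∧ ∀ b i o, i < b → o < b → ∃ p, Realizes p f T b i o

namespace PolyTime

variable {α β γ δ : Type} [Code α] [Code β] [Code γ] [Code δ]

/-- A program sees only codes, so the program for `f` serves for `g`. Only the weight of the result,
which may exceed the size of its code, needs a separate bound. -/
theorem congr_enc {f : α → β} {g : α → γ} (hf : PolyTime f) (h : ∀ a, enc (g a) = enc (f a))
    (hg : PolyBdd wt fun a => wt (g a)) : PolyTime g := by
  obtain ⟨-, T, hT, hp⟩ := hf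
  refine ⟨hg, T, hT, fun b i o hi ho => (hp b i o hi ho).imp fun p hp a σ hσ => ?_⟩
  rw [h]
  exact hp a σ hσ

@[fun_prop]
theorem id : PolyTime (fun a : α => a) := by
  refine ⟨.self, fun _ => 1, .const 1, fun b i o _ _ => ⟨.copy o i, fun a σ hσ => ?_⟩⟩
  exact ⟨_, 1, le_rfl, .copy o i σ, by simp [hσ], fun y _ hy => by simp [hy]⟩

/-- A function that does not change the code. -/
theorem of_enc {f : α → β} (h : ∀ a, enc (f a) = enc a) (hf : PolyBdd wt fun a => wt (f a)) :
    PolyTime f :=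
  id.congr_enc h hf

@[fun_prop]
theorem comp {g : β → γ} {f : α → β} (hg : PolyTime g) (hf : PolyTime f) :
    PolyTime (fun a => g (f a)) := by
  obtain ⟨hg0, T, hT, hp⟩ := hg
  obtain ⟨hf0, U, hU, hq⟩ := hf
  refine ⟨hg0.comp hf0, fun a => U a + T (f a), hU.add (hT.comp hf0), fun b i o hi ho => ?_⟩
  -- Register `b` is the first scratch register and holds `f a`; each subprogram must preserve
  -- everything below `b + 1` except its output.
  obtain ⟨q, hq⟩ := hq (b + 1) i b (by omega) (by omega)
  obtain ⟨p, hp⟩ := hp (b + 1) b o (by omega) (by omega)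
  refine ⟨.seq q p, fun a σ hσ => ?_⟩
  obtain ⟨τ, t, ht, hx, ho1, hy⟩ := hq a σ hσ
  obtain ⟨ρ, u, hu, hx', ho2, hy'⟩ := hp (f a) τ ho1
  refine ⟨ρ, t + u, by dsimp only; omega, .seq hx hx', ho2, fun y hyb hyo => ?_⟩
  rw [hy' y (by omega) hyo, hy y (by omega) (by omega)]

/-- The tree is built node by node. Each `cons` costs the size of the whole subtree built, hence the
quadratic time. -/
theorem const_cell (c : Cell) : PolyTime (fun _ : α => c) := by
  refine ⟨.const _, fun _ => c.size * c.size, .const _, ?_⟩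
  induction c with
  | nil =>
    intro b i o _ _
    exact ⟨.setNil o, fun a σ _ => ⟨_, 1, by simp [Cell.size], .setNil o σ, by simp [enc],
      fun y _ hy => by simp [hy]⟩⟩
  | cons c d ihc ihd =>
    intro b i o hi ho
    obtain ⟨p, hp⟩ := ihc (b + 1) i b (by omega) (by omega)
    obtain ⟨q, hq⟩ := ihd (b + 2) i (b + 1) (by omega) (by omega)
    refine ⟨.seq p (.seq q (.setCons o b (b + 1))), fun a σ hσ => ?_⟩
    obtain ⟨τ, t, ht, hx, ho1, hy⟩ := hp a σ hσ
    obtain ⟨ρ, u, hu, hx', ho2, hy'⟩ := hq a τ (by rw [hy i (by omega) (by omega), hσ])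
    have h1 : ρ b = c := by rw [hy' b (by omega) (by omega), ho1]; rfl
    have h2 : ρ (b + 1) = d := ho2
    refine ⟨_, _, ?_, .seq hx (.seq hx' (.setCons o b (b + 1) ρ)), ?_, fun y hyb hyo => ?_⟩
    · rw [h1, h2]
      have := c.size_pos
      have := d.size_pos
      simp only [Cell.size]
      nlinarith
    · simp [h1, h2, enc]
    · rw [Function.update_of_ne hyo, hy' y (by omega) (by omega), hy y (by omega) (by omega)]

@[fun_prop]
theorem const (c : β) : PolyTime (fun _ : α => c) :=
  (const_cell (enc c)).congr_enc (fun _ => rfl) (.const _)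

@[fun_prop]
theorem pair {f : α → β} {g : α → γ} (hf : PolyTime f) (hg : PolyTime g) :
    PolyTime (fun a => (f a, g a)) := by
  obtain ⟨hf0, T, hT, hp⟩ := hf
  obtain ⟨hg0, U, hU, hq⟩ := hg
  have hw : PolyBdd wt fun a => wt (f a, g a) := (hf0.add hg0).add (.const 1)
  refine ⟨hw, fun a => T a + U a + wt (f a, g a), (hT.add hU).add hw, fun b i o hi ho => ?_⟩
  obtain ⟨p, hp⟩ := hp (b + 1) i b (by omega) (by omega)
  obtain ⟨q, hq⟩ := hq (b + 2) i (b + 1) (by omega) (by omega)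
  refine ⟨.seq p (.seq q (.setCons o b (b + 1))), fun a σ hσ => ?_⟩
  obtain ⟨τ, t, ht, hx, ho1, hy⟩ := hp a σ hσ
  obtain ⟨ρ, u, hu, hx', ho2, hy'⟩ := hq a τ (by rw [hy i (by omega) (by omega), hσ])
  have h1 : ρ b = enc (f a) := by rw [hy' b (by omega) (by omega), ho1]
  refine ⟨_, _, ?_, .seq hx (.seq hx' (.setCons o b (b + 1) ρ)), ?_, fun y hyb hyo => ?_⟩
  · rw [h1, ho2]
    have : (Cell.cons (enc (f a)) (enc (g a))).size ≤ wt (f a, g a) := size_le (f a, g a)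
    dsimp only
    omega
  · rw [Function.update_self, h1, ho2]; rfl
  · rw [Function.update_of_ne hyo, hy' y (by omega) (by omega), hy y (by omega) (by omega)]

@[fun_prop]
theorem fst {f : α → β × γ} (hf : PolyTime f) : PolyTime (fun a => (f a).1) := by
  refine comp (g := Prod.fst) ⟨PolyBdd.self.mono fun z => by simp only [wt_prod]; omega,
    fun _ => 1, .const 1, fun b i o _ _ => ⟨.setHead o i, fun a σ hσ => ?_⟩⟩ hf
  exact ⟨_, 1, le_rfl, .setHead o i σ, by rw [Function.update_self, hσ]; rfl,
    fun y _ hy => by simp [hy]⟩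

@[fun_prop]
theorem snd {f : α → β × γ} (hf : PolyTime f) : PolyTime (fun a => (f a).2) := by
  refine comp (g := Prod.snd) ⟨PolyBdd.self.mono fun z => by simp only [wt_prod]; omega,
    fun _ => 1, .const 1, fun b i o _ _ => ⟨.setTail o i, fun a σ hσ => ?_⟩⟩ hf
  exact ⟨_, 1, le_rfl, .setTail o i σ, by rw [Function.update_self, hσ]; rfl,
    fun y _ hy => by simp [hy]⟩

@[fun_prop]
theorem subtype_val {p : β → Prop} {f : α → {b // p b}} (hf : PolyTime f) :
    PolyTime (fun a => (f a).1) :=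
  comp (g := Subtype.val) (of_enc (fun _ => rfl) .self) hf

theorem subtype_mk {p : β → Prop} {f : α → β} (hf : PolyTime f) (h : ∀ a, p (f a)) :
    PolyTime (fun a => (⟨f a, h a⟩ : {b // p b})) :=
  hf.congr_enc (fun _ => rfl) hf.1

@[fun_prop]
theorem ite {c : α → Bool} {f g : α → β} (hc : PolyTime c) (hf : PolyTime f) (hg : PolyTime g) :
    PolyTime (fun a => if c a then f a else g a) := by
  obtain ⟨-, V, hV, hr⟩ := hc
  obtain ⟨hf0, T, hT, hp⟩ := hf
  obtain ⟨hg0, U, hU, hq⟩ := hg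
  refine ⟨(hf0.add hg0).mono fun a => by dsimp only; split <;> omega,
    fun a => V a + (T a + U a + 1), hV.add ((hT.add hU).add (.const 1)), fun b i o hi ho => ?_⟩
  obtain ⟨r, hr⟩ := hr (b + 1) i b (by omega) (by omega)
  obtain ⟨p, hp⟩ := hp b i o hi ho
  obtain ⟨q, hq⟩ := hq b i o hi ho
  refine ⟨.seq r (.ite b p q), fun a σ hσ => ?_⟩
  obtain ⟨τ, t, ht, hx, ho1, hy⟩ := hr a σ hσ
  have hi' : τ i = enc a := by rw [hy i (by omega) (by omega), hσ]
  cases hca : c a with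
  | true =>
    obtain ⟨ρ, u, hu, hx', ho2, hy'⟩ := hp a τ hi'
    refine ⟨ρ, _, ?_, .seq hx (.ite_then ?_ hx'), by simpa [hca] using ho2, fun y hyb hyo => ?_⟩
    · dsimp only; omega
    · rw [ho1, hca]; simp [enc, encBool]
    · rw [hy' y hyb hyo, hy y (by omega) (by omega)]
  | false =>
    obtain ⟨ρ, u, hu, hx', ho2, hy'⟩ := hq a τ hi'
    refine ⟨ρ, _, ?_, .seq hx (.ite_else ?_ hx'), by simpa [hca] using ho2, fun y hyb hyo => ?_⟩
    · dsimp only; omega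
    · rw [ho1, hca]; rfl
    · rw [hy' y hyb hyo, hy y (by omega) (by omega)]

theorem isEmpty : PolyTime (fun l : List α => l.isEmpty) := by
  refine ⟨(PolyBdd.const 3).mono fun l => ?_, fun _ => 5, .const 5, fun b i o hi ho => ?_⟩
  · cases l <;> simp [wt, encBool, Cell.size]
  refine ⟨.seq (.setNil b) (.ite i (.setNil o) (.setCons o b b)), fun l σ hσ => ?_⟩
  cases l with
  | nil =>
    refine ⟨_, _, ?_, .seq (.setNil b σ) (.ite_else ?_ (.setCons o b b _)), ?_, ?_⟩
    · simp [Cell.size]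
    · rw [Function.update_of_ne (by omega), hσ]; rfl
    · simp [enc, encBool]
    · intro y hy hyo
      rw [Function.update_of_ne hyo, Function.update_of_ne (by omega)]
  | cons a l =>
    refine ⟨_, _, ?_, .seq (.setNil b σ) (.ite_then ?_ (.setNil o _)), ?_, ?_⟩
    · simp
    · rw [Function.update_of_ne (by omega), hσ]; simp [enc, encList]
    · simp [enc, encBool]
    · intro y hy hyo
      rw [Function.update_of_ne hyo, Function.update_of_ne (by omega)]

/-- This is the only source of loops. Iterating a polynomial-time step can make the accumulator grow
exponentially, so `B` must bound it after every prefix of the list. The step need only be fast on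
elements of the list. -/
theorem foldl {l : α → List β} {init : α → γ} {step : α → γ → β → γ} (hl : PolyTime l)
    (hi : PolyTime init)
    (hs : PolyTime fun z : {z : α × γ × β // z.2.2 ∈ l z.1} => step z.1.1 z.1.2.1 z.1.2.2)
    {B : α → ℕ} (hB : PolyBdd wt B)
    (hw : ∀ a m, m <+: l a → wt (m.foldl (step a) (init a)) ≤ B a) :
    PolyTime fun a => (l a).foldl (step a) (init a) := by
  obtain ⟨hl0, T, hT, hp⟩ := hl
  obtain ⟨-, U, hU, hq⟩ := hi
  obtain ⟨-, V, ⟨k, hV⟩, hr⟩ := hs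
  -- `W` bounds the weight of the triple (argument, accumulator, element) that is passed to the
  -- step.
  let W : α → ℕ := fun a => wt a + (B a + wt (l a) + 1) + 1
  have hW : PolyBdd wt W := (PolyBdd.self.add ((hB.add hl0).add (.const 1))).add (.const 1)
  -- `M` bounds one pass: two `cons` operations, the step, and one unit each for head, tail and loop
  -- test.
  let M : α → ℕ := fun a => W a + W a + (W a + 2) ^ k + 3
  have hM : PolyBdd wt M :=
    ((hW.add hW).add ((hW.add (.const 2)).pow k)).add (.const 3)
  refine ⟨hB.mono fun a => hw a _ List.prefix_rfl,
    fun a => T a + (U a + (wt (l a) * M a + 1 + 1)),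
    hT.add (hU.add (((hl0.mul hM).add (.const 1)).add (.const 1))), fun b i o hi ho => ?_⟩
  obtain ⟨p, hp⟩ := hp (b + 1) i b (by omega) (by omega)
  obtain ⟨q, hq⟩ := hq (b + 2) i (b + 1) (by omega) (by omega)
  obtain ⟨r, hr⟩ := hr (b + 5) (b + 4) (b + 1) (by omega) (by omega)
  -- Register `b` holds the remaining list, `b + 1` the accumulator and `b + 2` the current element;
  -- `b + 3` and `b + 4` build the argument of the step.
  let body : Prog := .seq (.setHead (b + 2) b) (.seq (.setTail b b)
    (.seq (.setCons (b + 3) (b + 1) (b + 2)) (.seq (.setCons (b + 4) i (b + 3)) r)))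
  -- Loop invariant: `m` has been consumed, `n` remains.
  have loop : ∀ (a : α) (m n : List β), l a = m ++ n → ∀ σ : Store, σ b = enc n → σ i = enc a →
      σ (b + 1) = enc (m.foldl (step a) (init a)) → ∃ (τ : Store) (t : ℕ),
      t ≤ n.length * M a + 1 ∧ Exec (.loop b body) σ τ t ∧
      τ (b + 1) = enc ((l a).foldl (step a) (init a)) ∧ ∀ y < b, τ y = σ y := by
    intro a m n
    induction n generalizing m with
    | nil =>
      intro h σ h1 h2 h3
      rw [List.append_nil] at h
      exact ⟨σ, 1, by simp, Exec.loop_stop h1, by rw [h, h3], fun _ _ => rfl⟩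
    | cons x n ih =>
      intro h σ h1 h2 h3
      let s := m.foldl (step a) (init a)
      have hx : x ∈ l a := by rw [h]; simp
      let σ1 := Function.update σ (b + 2) (σ b).head
      let σ2 := Function.update σ1 b (σ1 b).tail
      let σ3 := Function.update σ2 (b + 3) (.cons (σ2 (b + 1)) (σ2 (b + 2)))
      let σ4 := Function.update σ3 (b + 4) (.cons (σ3 i) (σ3 (b + 3)))
      have e1 : σ2 (b + 1) = enc s := by simp [σ2, σ1, h3, s]
      have e2 : σ2 (b + 2) = enc x := by simp [σ2, σ1, h1, enc, encList, Cell.head]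
      have e3 : σ2 b = enc n := by simp [σ2, σ1, h1, enc, encList, Cell.tail]
      have e4 : σ3 i = enc a := by
        simp only [σ3, σ2, σ1]
        rw [Function.update_of_ne (by omega), Function.update_of_ne (by omega),
          Function.update_of_ne (by omega), h2]
      have e5 : σ3 (b + 3) = enc (s, x) := by simp [σ3, e1, e2]; rfl
      have e6 : σ4 (b + 4) = enc (⟨(a, s, x), hx⟩ : {z : α × γ × β // z.2.2 ∈ l z.1}) := by
        simp [σ4, e4, e5]; rfl
      have e7 : ∀ y < b, σ4 y = σ y := by
        intro y hy
        simp only [σ4, σ3, σ2, σ1]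
        rw [Function.update_of_ne (by omega), Function.update_of_ne (by omega),
          Function.update_of_ne (by omega), Function.update_of_ne (by omega)]
      have e8 : σ4 b = enc n := by simp [σ4, σ3, e3]
      obtain ⟨τ, t, ht, hex, hτ1, hτ⟩ := hr _ σ4 e6
      have hs' : step a s x = (m ++ [x]).foldl (step a) (init a) := by simp [s]
      obtain ⟨ρ, u, hu, hex', hρ1, hρ⟩ := ih (m ++ [x]) (by simp [h]) τ
        (by rw [hτ b (by omega) (by omega), e8])
        (by rw [hτ i (by omega) (by omega), e7 i (by omega), h2]) (by rw [hτ1, ← hs'])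
      refine ⟨ρ, _, ?_, .loop_step ?_ (.seq (.setHead _ _ _) (.seq (.setTail _ _ _)
        (.seq (.setCons _ _ _ _) (.seq (.setCons _ _ _ _) hex)))) hex', hρ1, fun y hy => ?_⟩
      · have w1 : wt s ≤ B a := hw a m ⟨x :: n, h.symm⟩
        have w2 : wt x ≤ wt (l a) := (wt_lt_of_mem hx).le
        have w3 : wt (a, s, x) ≤ W a := by simp only [wt_prod, W]; omega
        have c1 : (Cell.cons (σ2 (b + 1)) (σ2 (b + 2))).size ≤ W a := by
          rw [e1, e2]
          refine (size_le (s, x)).trans ?_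
          simp only [wt_prod, W]; omega
        have c2 : (Cell.cons (σ3 i) (σ3 (b + 3))).size ≤ W a := by
          rw [e4, e5]
          exact (size_le (a, s, x)).trans w3
        have c3 : t ≤ (W a + 2) ^ k :=
          ht.trans ((hV _).trans (Nat.pow_le_pow_left (Nat.add_le_add_right w3 2) k))
        have c4 : (x :: n).length * M a = n.length * M a + M a := by
          rw [List.length_cons, add_mul, one_mul]
        rw [c4]
        have c5 : M a = W a + W a + (W a + 2) ^ k + 3 := rfl
        change 1 + (1 + ((Cell.cons (σ2 (b + 1)) (σ2 (b + 2))).size +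
          ((Cell.cons (σ3 i) (σ3 (b + 3))).size + t))) + u + 1 ≤ _
        omega
      · rw [h1]; simp [enc, encList]
      · rw [hρ y hy, hτ y (by omega) (by omega), e7 y hy]
  refine ⟨.seq p (.seq q (.seq (.loop b body) (.copy o (b + 1)))), fun a σ hσ => ?_⟩
  obtain ⟨σ1, t1, ht1, hx1, ho1, hy1⟩ := hp a σ hσ
  obtain ⟨σ2, t2, ht2, hx2, ho2, hy2⟩ := hq a σ1 (by rw [hy1 i (by omega) (by omega), hσ])
  obtain ⟨σ3, t3, ht3, hx3, ho3, hy3⟩ := loop a [] (l a) rfl σ2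
    (by rw [hy2 b (by omega) (by omega), ho1])
    (by rw [hy2 i (by omega) (by omega), hy1 i (by omega) (by omega), hσ]) ho2
  refine ⟨_, _, ?_, .seq hx1 (.seq hx2 (.seq hx3 (.copy o (b + 1) σ3))), ?_, fun y hy hyo => ?_⟩
  · have := Nat.mul_le_mul_right (M a) (length_lt_wt (l a)).le
    dsimp only
    omega
  · rw [Function.update_self, ho3]
  · rw [Function.update_of_ne hyo, hy3 y hy, hy2 y (by omega) (by omega), hy1 y (by omega) (by omega)]

end PolyTime

theorem wt_flatMap_le {α β : Type} [Code β] {l : List α} {f : α → List β} {B : ℕ} (h : ∀ a ∈ l, wt (f a) ≤ B) :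
    wt (l.flatMap f) ≤ l.length * B + 1 := by
  induction l with
  | nil => simp
  | cons a l ih =>
    have h1 := ih fun b hb => h b (List.mem_cons_of_mem _ hb)
    have h2 := h a List.mem_cons_self
    have h3 := wt_append (f a) (l.flatMap f)
    rw [List.flatMap_cons, List.length_cons, add_mul]
    omega

namespace PolyTime

variable {α β γ δ : Type} [Code α] [Code β] [Code γ] [Code δ]

/-! ### Booleans and lists -/

@[fun_prop]
theorem bnot {c : α → Bool} (hc : PolyTime c) : PolyTime fun a => !c a := by
  have : (fun a => !c a) = fun a => if c a then false else true := by
    funext a; cases c a <;> rfl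
  rw [this]
  fun_prop

@[fun_prop]
theorem band {c d : α → Bool} (hc : PolyTime c) (hd : PolyTime d) :
    PolyTime fun a => c a && d a := by
  have : (fun a => c a && d a) = fun a => if c a then d a else false := by
    funext a; cases c a <;> rfl
  rw [this]
  fun_prop

@[fun_prop]
theorem list_isEmpty {l : α → List β} (hl : PolyTime l) : PolyTime fun a => (l a).isEmpty :=
  isEmpty.comp hl

@[fun_prop]
theorem list_cons {f : α → β} {l : α → List β} (hf : PolyTime f) (hl : PolyTime l) :
    PolyTime fun a => f a :: l a :=
  (hf.pair hl).congr_enc (fun _ => rfl) ((hf.pair hl).1.mono fun a => by rw [wt_cons, wt_prod])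

theorem cell_head : PolyTime Cell.head := by
  refine ⟨PolyBdd.self.mono fun c => ?_, fun _ => 1, .const 1, fun b i o _ _ =>
    ⟨.setHead o i, fun c σ hσ => ⟨_, 1, le_rfl, .setHead o i σ, ?_, fun y _ hy => by simp [hy]⟩⟩⟩
  · cases c <;> simp [wt, Cell.head, Cell.size]
    omega
  · rw [Function.update_self, hσ]; rfl

theorem cell_tail : PolyTime Cell.tail := by
  refine ⟨PolyBdd.self.mono fun c => ?_, fun _ => 1, .const 1, fun b i o _ _ =>
    ⟨.setTail o i, fun c σ hσ => ⟨_, 1, le_rfl, .setTail o i σ, ?_, fun y _ hy => by simp [hy]⟩⟩⟩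
  · cases c <;> simp [wt, Cell.tail, Cell.size]
    omega
  · rw [Function.update_self, hσ]; rfl

theorem encode : PolyTime (fun a : α => enc a) :=
  of_enc (fun _ => rfl) (PolyBdd.self.mono size_le)

@[fun_prop]
theorem list_tail {l : α → List β} (hl : PolyTime l) : PolyTime fun a => (l a).tail :=
  comp (g := List.tail)
    ((cell_tail.comp encode).congr_enc (fun l => by cases l <;> rfl)
      (PolyBdd.self.mono fun l => wt_sublist l.tail_sublist)) hl

@[fun_prop]
theorem list_head? {l : α → List β} (hl : PolyTime l) : PolyTime fun a => (l a).head? := by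
  -- `none` and `some a` have the same codes as the empty list and a one-element list.
  have h : PolyTime fun l : List β =>
      if l.isEmpty then ([] : List Cell) else [Cell.head (enc l)] := by
    have h1 := cell_head.comp (encode (α := List β))
    fun_prop
  refine comp (g := List.head?) (h.congr_enc (fun l => by cases l <;> rfl)
    ((PolyBdd.self.add (.const 1)).mono fun l => ?_)) hl
  cases l with
  | nil => simp [wt]
  | cons a l =>
    have := wt_pos l
    simp only [wt_cons, List.head?_cons]
    change wt a + 2 ≤ _
    omega

@[fun_prop]
theorem list_headD {l : α → List β} {d : α → β} (hl : PolyTime l) (hd : PolyTime d) :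
    PolyTime fun a => (l a).headD (d a) := by
  have h : PolyTime fun a => if (l a).isEmpty then enc (d a) else Cell.head (enc (l a)) := by
    have h1 := (cell_head.comp encode).comp hl
    have h2 := encode.comp hd
    fun_prop
  refine h.congr_enc (fun a => by cases l a <;> rfl) ((hd.1.add hl.1).mono fun a => ?_)
  cases l a with
  | nil => simp
  | cons b m => simp only [wt_cons, List.headD_cons]; omega

-- A fold can only push elements onto the front, so reversal onto an accumulator is the basic
-- operation; appending is two reversals.
@[fun_prop]
theorem list_reverseAux {l m : α → List β} (hl : PolyTime l) (hm : PolyTime m) :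
    PolyTime fun a => (l a).reverseAux (m a) := by
  have key : ∀ l m : List β, l.foldl (fun s b => b :: s) m = l.reverseAux m := by
    intro l
    induction l with
    | nil => intro m; rfl
    | cons b l ih => intro m; exact ih (b :: m)
  simp only [← key]
  refine foldl hl hm (by fun_prop) (hl.1.add hm.1) fun a n hn => ?_
  have h1 := wt_append n.reverse (m a)
  have h2 := wt_sublist hn.sublist
  rw [wt_reverse] at h1
  rw [key, List.reverseAux_eq]
  omega

@[fun_prop]
theorem list_reverse {l : α → List β} (hl : PolyTime l) : PolyTime fun a => (l a).reverse :=
  list_reverseAux hl (const [])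

@[fun_prop]
theorem list_append {l m : α → List β} (hl : PolyTime l) (hm : PolyTime m) :
    PolyTime fun a => l a ++ m a := by
  have h := list_reverseAux (list_reverse hl) hm
  simpa only [List.reverseAux_eq, List.reverse_reverse] using h

/-- The restriction to members of the list matters for `candidates`, where the number of fillings is
bounded only for selectors of the library. -/
theorem list_flatMap_of_mem {l : α → List β} {f : α → β → List γ} (hl : PolyTime l)
    (hf : PolyTime fun z : {z : α × β // z.2 ∈ l z.1} => f z.1.1 z.1.2) :
    PolyTime fun a => (l a).flatMap (f a) := by
  obtain ⟨k, hk⟩ := hf.1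
  have key : ∀ (a : α) (m : List β) (n : List γ),
      m.foldl (fun s b => (f a b).reverseAux s) n = (m.flatMap (f a)).reverse ++ n := by
    intro a m
    induction m with
    | nil => intro n; rfl
    | cons b m ih =>
      intro n
      rw [List.foldl_cons, ih, List.flatMap_cons, List.reverse_append, List.reverseAux_eq,
        List.append_assoc]
  have h : PolyTime fun a => (l a).foldl (fun s b => (f a b).reverseAux s) [] := by
    refine foldl (B := fun a => wt (l a) * (wt a + wt (l a) + 1 + 2) ^ k + 1) hl (const [])
      ?_ ((hl.1.mul ((((PolyBdd.self.add hl.1).add (.const 1)).add (.const 2)).pow k)).add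
        (.const 1)) fun a m hm => ?_
    · have h1 : PolyTime fun z : {z : α × List γ × β // z.2.2 ∈ l z.1} =>
          (⟨(z.1.1, z.1.2.2), z.2⟩ : {z : α × β // z.2 ∈ l z.1}) :=
        subtype_mk (f := fun z : {z : α × List γ × β // z.2.2 ∈ l z.1} => (z.1.1, z.1.2.2))
          (by fun_prop) fun z => z.2
      exact list_reverseAux (hf.comp h1) (by fun_prop)
    · rw [key, List.append_nil, wt_reverse]
      refine (wt_flatMap_le (B := (wt a + wt (l a) + 1 + 2) ^ k) fun b hb => ?_).trans ?_
      · refine (hk ⟨(a, b), hm.subset hb⟩).trans (Nat.pow_le_pow_left ?_ k)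
        have := wt_lt_of_mem (hm.subset hb)
        change wt a + wt b + 1 + 2 ≤ _
        omega
      · have h1 := hm.length_le
        have h2 := length_lt_wt (l a)
        exact Nat.add_le_add_right (Nat.mul_le_mul_right _ (by omega)) 1
  have h2 := list_reverse h
  simpa only [key, List.append_nil, List.reverse_reverse] using h2

@[fun_prop]
theorem list_flatMap {l : α → List β} {f : α → β → List γ} (hl : PolyTime l)
    (hf : PolyTime fun z : α × β => f z.1 z.2) :
    PolyTime fun a => (l a).flatMap (f a) :=
  list_flatMap_of_mem hl (hf.comp (subtype_val id))

@[fun_prop]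
theorem list_map {l : α → List β} {f : α → β → γ} (hl : PolyTime l)
    (hf : PolyTime fun z : α × β => f z.1 z.2) : PolyTime fun a => (l a).map (f a) := by
  simp only [List.map_eq_flatMap]
  fun_prop

@[fun_prop]
theorem list_filter {l : α → List β} {p : α → β → Bool} (hl : PolyTime l)
    (hp : PolyTime fun z : α × β => p z.1 z.2) : PolyTime fun a => (l a).filter (p a) := by
  have : ∀ a, (l a).filter (p a) = (l a).flatMap fun b => if p a b then [b] else [] := by
    intro a
    induction l a with
    | nil => rfl
    | cons b m ih => rw [List.flatMap_cons, ← ih, List.filter_cons]; split <;> rfl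
  simp only [this]
  fun_prop

@[fun_prop]
theorem list_all {l : α → List β} {p : α → β → Bool} (hl : PolyTime l)
    (hp : PolyTime fun z : α × β => p z.1 z.2) : PolyTime fun a => (l a).all (p a) := by
  have : ∀ a, (l a).all (p a) = ((l a).filter fun b => !p a b).isEmpty := by
    intro a
    rw [Bool.eq_iff_iff]
    simp
  simp only [this]
  fun_prop

@[fun_prop]
theorem list_any {l : α → List β} {p : α → β → Bool} (hl : PolyTime l)
    (hp : PolyTime fun z : α × β => p z.1 z.2) : PolyTime fun a => (l a).any (p a) := by
  simp only [List.any_eq_not_all_not]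
  fun_prop

@[fun_prop]
theorem list_find? {l : α → List β} {p : α → β → Bool} (hl : PolyTime l)
    (hp : PolyTime fun z : α × β => p z.1 z.2) : PolyTime fun a => (l a).find? (p a) := by
  simp only [← List.head?_filter]
  fun_prop

end PolyTime

/-! ### Equality tests -/

/-- Types with an equality test in polynomial time. -/
class CodeEq (α : Type) [Code α] [DecidableEq α] : Prop where
  polyTime : PolyTime fun z : α × α => decide (z.1 = z.2)

namespace PolyTime

variable {α β γ : Type} [Code α] [Code β] [Code γ]

@[fun_prop]
theorem decide_eq [DecidableEq β] [CodeEq β] {f g : α → β} (hf : PolyTime f)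
    (hg : PolyTime g) : PolyTime fun a => decide (f a = g a) :=
  CodeEq.polyTime.comp (hf.pair hg)

end PolyTime

instance : CodeEq Bool where
  polyTime := by
    have : (fun z : Bool × Bool => decide (z.1 = z.2)) = fun z => if z.1 then z.2 else !z.2 := by
      funext ⟨a, b⟩; cases a <;> cases b <;> rfl
    rw [this]
    fun_prop

instance {α β : Type} [Code α] [Code β] [DecidableEq α] [DecidableEq β] [CodeEq α] [CodeEq β] :
    CodeEq (α × β) where
  polyTime := by
    have : (fun z : (α × β) × (α × β) => decide (z.1 = z.2)) =
        fun z => decide (z.1.1 = z.2.1) && decide (z.1.2 = z.2.2) := by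
      funext z
      rw [Bool.eq_iff_iff]
      simp [Prod.ext_iff]
    rw [this]
    fun_prop

instance {α : Type} [Code α] [DecidableEq α] [CodeEq α] : CodeEq (List α) where
  polyTime := by
    -- The fold over the first list consumes the second one. The default `a` in `headD` is harmless,
    -- since the emptiness test already rejects a second list that is too short; one that is too
    -- long leaves a nonempty remainder.
    let step : List α × Bool → α → List α × Bool := fun s a =>
      (s.1.tail, s.2 && !s.1.isEmpty && decide (a = s.1.headD a))
    have key : ∀ (l m : List α) (b : Bool), (l.foldl step (m, b)).1.Sublist m ∧
        ((l.foldl step (m, b)).2 && (l.foldl step (m, b)).1.isEmpty) =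
          (b && decide (l = m)) := by
      intro l
      induction l with
      | nil => intro m b; cases m <;> simp
      | cons a l ih =>
        intro m b
        refine ⟨(ih m.tail _).1.trans m.tail_sublist, ?_⟩
        rw [List.foldl_cons, (ih _ _).2]
        cases m with
        | nil => simp
        | cons c m =>
          rw [Bool.eq_iff_iff]
          cases b <;> simp
          exact fun _ => decide_eq_true_iff
    have h : PolyTime fun z : List α × List α => z.1.foldl step (z.2, true) := by
      refine PolyTime.foldl (by fun_prop) (by fun_prop) (by fun_prop)
        (PolyBdd.self.add (.const 5)) fun z n _ => ?_
      have h1 := wt_sublist (key n z.2 true).1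
      have h2 : ∀ b : Bool, wt b ≤ 3 := by intro b; cases b <;> simp [wt, encBool, Cell.size]
      have h3 := h2 (n.foldl step (z.2, true)).2
      rw [wt_prod, wt_prod]
      omega
    have h2 : PolyTime fun z : List α × List α =>
        (z.1.foldl step (z.2, true)).2 && (z.1.foldl step (z.2, true)).1.isEmpty := by
      fun_prop
    simpa only [key, Bool.true_and] using h2

theorem bits_injective : Function.Injective Nat.bits := by
  have : Function.LeftInverse (fun l : List Bool => l.foldr (fun b n => Nat.bit b n) 0) Nat.bits := by
    intro n
    induction n using Nat.binaryRec' with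
    | zero => simp
    | bit b n h ih =>
      rw [Nat.bits_append_bit n b h]
      exact congrArg (Nat.bit b) ih
  exact this.injective

theorem wt_bits (n : ℕ) : wt n.bits = wt n := by
  change _ = (encList encBool n.bits).size
  induction n.bits with
  | nil => rfl
  | cons b l ih => rw [wt_cons, ih]; rfl

/-- A crude bound, linear in the value, is enough for counters that stay below the length of a list.
-/
theorem wt_nat_le (n : ℕ) : wt n ≤ n * 4 + 1 := by
  rw [← wt_bits]
  refine (wt_le_of_forall (B := 3) fun b _ => ?_).trans ?_
  · cases b <;> simp [wt, encBool, Cell.size]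
  · rw [Nat.size_eq_bits_len]
    have := Nat.size_le.2 (Nat.lt_two_pow_self (n := n))
    omega

namespace PolyTime

variable {α β γ : Type} [Code α] [Code β] [Code γ]

theorem bits : PolyTime Nat.bits :=
  of_enc (fun _ => rfl) (PolyBdd.self.mono fun n => (wt_bits n).le)

end PolyTime

instance : CodeEq ℕ where
  polyTime := by
    have : (fun z : ℕ × ℕ => decide (z.1 = z.2)) = fun z => decide (z.1.bits = z.2.bits) := by
      funext z
      simp only [bits_injective.eq_iff]
    rw [this]
    have := PolyTime.bits
    fun_prop

/-! ### Numbers -/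

/-- Adding one to a number in binary. -/
def incBits : List Bool → List Bool
  | [] => [true]
  | false :: l => true :: l
  | true :: l => false :: incBits l

theorem bits_succ (n : ℕ) : (n + 1).bits = incBits n.bits := by
  induction n using Nat.binaryRec' with
  | zero => simp [incBits]
  | bit b n h ih =>
    rw [Nat.bits_append_bit n b h]
    cases b with
    | false => rw [incBits, ← Nat.bit1_bits]; rfl
    | true =>
      rw [incBits, ← ih, ← Nat.bit0_bits (n + 1) (by omega)]
      congr 1

/-- The membership test for lists. -/
def memb {α : Type} [DecidableEq α] (a : α) (l : List α) : Bool := l.any fun b => decide (a = b)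

theorem memb_eq_true {α : Type} [DecidableEq α] {a : α} {l : List α} :
    memb a l = true ↔ a ∈ l := by
  simp [memb]

namespace PolyTime

variable {α β γ : Type} [Code α] [Code β] [Code γ]

theorem incBits : PolyTime incBits := by
  -- The state is the reversed output together with the carry; a carry left at the end becomes a new
  -- leading bit.
  let step : List Bool × Bool → Bool → List Bool × Bool := fun s b =>
    ((if s.2 then !b else b) :: s.1, b && s.2)
  have key0 : ∀ (l m : List Bool), l.foldl step (m, false) = (l.reverse ++ m, false) := by
    intro l
    induction l with
    | nil => intro m; rfl
    | cons b l ih => intro m; simp [step, ih]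
  have key1 : ∀ (l m : List Bool), ((l.foldl step (m, true)).1.reverse ++
      if (l.foldl step (m, true)).2 then [true] else []) = m.reverse ++ CompSoft.incBits l := by
    intro l
    induction l with
    | nil => intro m; simp [CompSoft.incBits]
    | cons b l ih =>
      intro m
      cases b with
      | false => simp [step, key0, CompSoft.incBits]
      | true =>
        have : (true :: l).foldl step (m, true) = l.foldl step (false :: m, true) := rfl
        rw [this, ih]
        simp [CompSoft.incBits]
  have hlen : ∀ (l : List Bool) (s : List Bool × Bool),
      (l.foldl step s).1.length = s.1.length + l.length := by
    intro l
    induction l with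
    | nil => intro s; rfl
    | cons b l ih => intro s; rw [List.foldl_cons, ih]; simp [step]; omega
  have h2 : ∀ b : Bool, wt b ≤ 3 := by intro b; cases b <;> simp [wt, encBool, Cell.size]
  have h : PolyTime fun l : List Bool => l.foldl step ([], true) := by
    refine foldl id (const _) (by fun_prop)
      (B := fun l => wt l * 4 + 5) ((PolyBdd.self.mul (.const 4)).add (.const 5)) fun l n hn => ?_
    have h3 := h2 (n.foldl step ([], true)).2
    have h4 := wt_le_of_forall (l := (n.foldl step ([], true)).1) fun b _ => h2 b
    have h5 := hlen n ([], true)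
    have h6 := hn.length_le
    have h7 := length_lt_wt l
    rw [wt_prod]
    simp only [List.length_nil] at h5
    omega
  have h3 : PolyTime fun l : List Bool => (l.foldl step ([], true)).1.reverse ++
      if (l.foldl step ([], true)).2 then [true] else [] := by
    fun_prop
  simpa only [key1, List.reverse_nil, List.nil_append] using h3

@[fun_prop]
theorem succ {f : α → ℕ} (hf : PolyTime f) : PolyTime fun a => f a + 1 :=
  comp (g := Nat.succ) ((incBits.comp bits).congr_enc
    (fun n => congrArg (encList encBool) (bits_succ n))
    ((incBits.comp bits).1.mono fun n => by
      rw [← wt_bits, Nat.succ_eq_add_one, bits_succ])) hf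

@[fun_prop]
theorem list_zipIdx {l : α → List β} (hl : PolyTime l) : PolyTime fun a => (l a).zipIdx := by
  have key : ∀ (l : List β) (m : List (β × ℕ)) (n : ℕ),
      l.foldl (fun (s : List (β × ℕ) × ℕ) b => ((b, s.2) :: s.1, s.2 + 1)) (m, n) =
        ((l.zipIdx n).reverse ++ m, n + l.length) := by
    intro l
    induction l with
    | nil => intro m n; rfl
    | cons b l ih => intro m n; simp [ih]; omega
  have h : PolyTime fun l : List β =>
      l.foldl (fun (s : List (β × ℕ) × ℕ) b => ((b, s.2) :: s.1, s.2 + 1)) ([], 0) := by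
    refine foldl id (const _) (by fun_prop)
      (B := fun l => (wt l * (wt l + (wt l * 4 + 1) + 1 + 1) + 1) + (wt l * 4 + 1) + 1)
      (((PolyBdd.self.mul (((PolyBdd.self.add ((PolyBdd.self.mul (.const 4)).add (.const 1))).add
        (.const 1)).add (.const 1))).add (.const 1)).add
        ((PolyBdd.self.mul (.const 4)).add (.const 1)) |>.add (.const 1)) fun l n hn => ?_
    have h1 := hn.length_le
    have h2 := length_lt_wt l
    rw [key, wt_prod, List.append_nil, wt_reverse]
    have h3 := wt_nat_le (0 + n.length)
    have h4 : wt n.zipIdx ≤ n.zipIdx.length * (wt l + (wt l * 4 + 1) + 1 + 1) + 1 := by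
      refine wt_le_of_forall fun z hz => ?_
      have h5 := wt_lt_of_mem (hn.subset (List.fst_mem_of_mem_zipIdx hz))
      have h6 := List.snd_lt_of_mem_zipIdx hz
      have h7 := wt_nat_le z.2
      rw [wt_prod]
      omega
    rw [List.length_zipIdx] at h4
    have h8 := Nat.mul_le_mul_right (wt l + (wt l * 4 + 1) + 1 + 1) (h1.trans h2.le)
    dsimp only
    omega
  have h2 : PolyTime fun l : List β => (l.foldl
      (fun (s : List (β × ℕ) × ℕ) b => ((b, s.2) :: s.1, s.2 + 1)) ([], 0)).1.reverse := by
    fun_prop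
  simp only [key, List.append_nil, List.reverse_reverse] at h2
  exact h2.comp hl

@[fun_prop]
theorem list_memb [DecidableEq β] [CodeEq β] {f : α → β} {l : α → List β} (hf : PolyTime f)
    (hl : PolyTime l) : PolyTime fun a => memb (f a) (l a) := by
  unfold memb
  fun_prop

-- A number is less than the length exactly if it occurs among the indices. So comparing needs only
-- equality tests, and a huge binary number causes no trouble.
@[fun_prop]
theorem decide_lt_length {f : α → ℕ} {l : α → List β} (hf : PolyTime f) (hl : PolyTime l) :
    PolyTime fun a => decide (f a < (l a).length) := by
  have : ∀ a, decide (f a < (l a).length) = (l a).zipIdx.any fun z => decide (f a = z.2) := by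
    intro a
    rw [Bool.eq_iff_iff, decide_eq_true_iff, List.any_eq_true]
    constructor
    · intro h
      exact ⟨((l a)[f a], f a), List.mk_mem_zipIdx_iff_getElem?.2 (by simp [h]), by simp⟩
    · rintro ⟨z, hz, h⟩
      have := List.snd_lt_of_mem_zipIdx hz
      simp only [decide_eq_true_iff] at h
      omega
  simp only [this]
  fun_prop

end PolyTime

/-! ### Enumeration of the candidate systems -/

/-- All lists that consist of one more element of `L` than `s` has elements. -/
def tuples {β γ : Type} (L : List γ) (s : List β) : List (List γ) :=
  s.foldl (fun T _ => T.flatMap fun t => L.map fun p => p :: t) (L.map fun p => [p])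

/-- All pairs of an element `s` of `S` and a list of `s.length + 1` elements of `L`. -/
def candidates {β γ : Type} (S : List (List β)) (L : List γ) : List (List β × List γ) :=
  S.flatMap fun s => (tuples L s).map fun t => (s, t)

section tuples

variable {β γ : Type} {L : List γ}

theorem tuples_eq_iterate (s : List β) : tuples L s =
    (fun T => T.flatMap fun t => L.map fun p => p :: t)^[s.length] (L.map fun p => [p]) :=
  List.foldl_const _ _ _

theorem length_tuples (s : List β) : (tuples L s).length = L.length ^ (s.length + 1) := by
  rw [tuples_eq_iterate]
  induction s.length with
  | zero => simp
  | succ n ih =>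
    rw [Function.iterate_succ_apply', List.length_flatMap]
    simp only [List.length_map, List.map_const', List.sum_replicate, smul_eq_mul, ih]
    rw [pow_succ _ (n + 1)]

theorem mem_tuples {s : List β} {t : List γ} :
    t ∈ tuples L s ↔ t.length = s.length + 1 ∧ ∀ p ∈ t, p ∈ L := by
  rw [tuples_eq_iterate]
  generalize s.length = n
  induction n generalizing t with
  | zero =>
    constructor
    · intro h
      obtain ⟨p, hp, rfl⟩ := List.mem_map.1 h
      simpa using hp
    · rintro ⟨h1, h2⟩
      obtain ⟨p, rfl⟩ := List.length_eq_one_iff.1 h1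
      simpa using h2
  | succ n ih =>
    rw [Function.iterate_succ_apply', List.mem_flatMap]
    constructor
    · rintro ⟨u, hu, h⟩
      obtain ⟨p, hp, rfl⟩ := List.mem_map.1 h
      have := ih.1 hu
      simp [this.1, hp]
      exact this.2
    · rintro ⟨h1, h2⟩
      cases t with
      | nil => simp at h1
      | cons p u =>
        refine ⟨u, ih.2 ⟨by simpa using h1, fun q hq => h2 q (by simp [hq])⟩, ?_⟩
        exact List.mem_map.2 ⟨p, h2 p (by simp), rfl⟩

theorem mem_candidates {S : List (List β)} {s : List β} {t : List γ} :
    (s, t) ∈ candidates S L ↔ s ∈ S ∧ t.length = s.length + 1 ∧ ∀ p ∈ t, p ∈ L := by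
  simp only [candidates, List.mem_flatMap, List.mem_map, Prod.mk.injEq, ← mem_tuples]
  constructor
  · rintro ⟨s', hs, t', ht, rfl, rfl⟩
    exact ⟨hs, ht⟩
  · rintro ⟨hs, ht⟩
    exact ⟨s, hs, t, ht, rfl, rfl⟩

theorem length_le_foldr_max {S : List (List β)} {s : List β} (hs : s ∈ S) :
    s.length ≤ (S.map List.length).foldr max 0 := by
  induction S with
  | nil => simp at hs
  | cons u S ih =>
    rcases List.mem_cons.1 hs with rfl | h
    · exact le_max_left _ _
    · exact (ih h).trans (le_max_right _ _)

end tuples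

/-- The only step that is exponential in the parameters; `hw` requires the weight to pay for it. -/
theorem PolyTime.candidates {α β γ : Type} [Code α] [Code β] [Code γ] {S : α → List (List β)}
    {L : α → List γ} (hS : PolyTime S) (hL : PolyTime L)
    (hw : PolyBdd wt fun a => ((L a).length + 1) ^ (((S a).map List.length).foldr max 0 + 1)) :
    PolyTime fun a => candidates (S a) (L a) := by
  have hval : PolyTime fun z : {z : α × List β // z.2 ∈ S z.1} => z.1.1 := by fun_prop
  have hsel : PolyTime fun z : {z : α × List β // z.2 ∈ S z.1} => z.1.2 := by fun_prop
  have hlib : PolyTime fun z : {z : α × List β // z.2 ∈ S z.1} => L z.1.1 := by fun_prop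
  have h : PolyTime fun z : {z : α × List β // z.2 ∈ S z.1} => tuples (L z.1.1) z.1.2 := by
    refine foldl hsel (by fun_prop) (by fun_prop)
      -- The number of tuples times a bound for the weight of one tuple.
      (B := fun z => ((L z.1.1).length + 1) ^ (((S z.1.1).map List.length).foldr max 0 + 1) *
        (((wt z.1.2 + 1) * (wt (L z.1.1) + 1) + 1) + 1) + 1)
      (((hw.comp hval.1).mul (((((hsel.1.add (.const 1)).mul (hlib.1.add (.const 1))).add
        (.const 1)).add (.const 1)))).add (.const 1)) fun z m hm => ?_
    have h1 := hm.length_le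
    have h2 := length_lt_wt z.1.2
    have h3 := length_le_foldr_max z.2
    change wt (tuples (L z.1.1) m) ≤ _
    refine (wt_le_of_forall (B := (wt z.1.2 + 1) * (wt (L z.1.1) + 1) + 1) fun t ht => ?_).trans ?_
    · obtain ⟨h4, h5⟩ := mem_tuples.1 ht
      refine (wt_le_of_forall fun p hp => (wt_lt_of_mem (h5 p hp)).le).trans ?_
      rw [h4]
      exact Nat.add_le_add_right (Nat.mul_le_mul_right _ (by omega)) 1
    · rw [length_tuples]
      refine Nat.add_le_add_right (Nat.mul_le_mul_right _ ?_) 1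
      -- The added 1 keeps the base positive, so the exponent can be raised even if the library is
      -- empty.
      exact (Nat.pow_le_pow_left (Nat.le_succ _) _).trans
        (Nat.pow_le_pow_right (Nat.succ_pos _) (by omega))
  refine list_flatMap_of_mem hS ?_
  fun_prop

/-! ### Untyped components -/

/-- These types do not depend on the instance, so one program can process all instances. -/
abbrev RawCond : Type := ℕ × Bool

abbrev RawProcedure : Type := List (RawCond × ℕ) × ℕ

abbrev RawSystem : Type := List RawCond × List RawProcedure

abbrev RawRequirement : Type := List Bool × ℕ

/-- A literal holds if its variable, used as an index, carries its sign as truth value. -/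
def RawCond.holds (c : RawCond) (s : List Bool) : Bool := memb (c.2, c.1) s.zipIdx

def RawProcedure.exec (p : RawProcedure) (s : List Bool) : ℕ :=
  ((p.1.filter fun b => RawCond.holds b.1 s).map fun b => b.2).headD p.2

/-- Each failing condition discards one procedure from the front; the flag freezes the list once a
condition has held. -/
def RawSystem.exec (S : RawSystem) (s : List Bool) : ℕ :=
  RawProcedure.exec ((S.1.foldl (fun (z : List RawProcedure × Bool) c =>
    if z.2 then z else if RawCond.holds c s then (z.1, true) else (z.1.tail, false))
    (S.2, false)).1.headD ([], 0)) s

def RawSystem.satisfies (S : RawSystem) (R : List RawRequirement) : Bool :=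
  R.all fun r => decide (S.exec r.1 = r.2)

/-- Removal of duplicates. -/
def distinct {α : Type} [DecidableEq α] (l : List α) : List α :=
  l.foldl (fun s p => if memb p s then s else p :: s) []

/-- The dummy entry in front counts the selector. -/
def RawSystem.typesLe (S : RawSystem) (d : ℕ) : Bool :=
  !decide (d < ((([], 0) : RawProcedure) :: distinct S.2).length)

/-- The entries of `m`, with their positions, that differ from the entry of `l` in that position. -/
def differences {α : Type} [DecidableEq α] (l m : List α) : List (α × ℕ) :=
  m.zipIdx.filter fun q => !memb q l.zipIdx

/-- The constant lists compare the numbers of slots in unary; the dummy entry counts a change of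
selector. -/
def RawSystem.distLe (S S' : RawSystem) (c : ℕ) : Bool :=
  decide (S'.2.map (fun _ => true) = S.2.map fun _ => true) &&
    !decide (c < ((if decide (S'.1 = S.1) then [] else [(([], 0), 0)]) ++
      differences S.2 S'.2).length)

namespace PolyTime

variable {α : Type} [Code α]

@[fun_prop]
theorem rawCond_holds {c : α → RawCond} {s : α → List Bool} (hc : PolyTime c) (hs : PolyTime s) :
    PolyTime fun a => RawCond.holds (c a) (s a) := by
  unfold RawCond.holds
  fun_prop

@[fun_prop]
theorem rawProcedure_exec {p : α → RawProcedure} {s : α → List Bool} (hp : PolyTime p)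
    (hs : PolyTime s) : PolyTime fun a => RawProcedure.exec (p a) (s a) := by
  unfold RawProcedure.exec
  fun_prop

@[fun_prop]
theorem rawSystem_exec {S : α → RawSystem} {s : α → List Bool} (hS : PolyTime S)
    (hs : PolyTime s) : PolyTime fun a => RawSystem.exec (S a) (s a) := by
  -- The list of procedures only shrinks, which bounds the accumulator.
  have key : ∀ (a : α) (m : List RawCond) (z : List RawProcedure × Bool),
      (m.foldl (fun (z : List RawProcedure × Bool) c => if z.2 then z else
        if RawCond.holds c (s a) then (z.1, true) else (z.1.tail, false)) z).1.Sublist z.1 := by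
    intro a m
    induction m with
    | nil => intro z; exact List.Sublist.refl _
    | cons c m ih =>
      intro z
      refine (ih _).trans ?_
      dsimp only
      split
      · exact List.Sublist.refl _
      · split
        · exact List.Sublist.refl _
        · exact z.1.tail_sublist
  have h2 : ∀ b : Bool, wt b ≤ 3 := by intro b; cases b <;> simp [wt, encBool, Cell.size]
  have h : PolyTime fun a => (S a).1.foldl (fun (z : List RawProcedure × Bool) c => if z.2 then z
      else if RawCond.holds c (s a) then (z.1, true) else (z.1.tail, false)) ((S a).2, false) := by
    refine foldl (by fun_prop) (by fun_prop) (by fun_prop)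
      ((snd hS).1.add (.const 4)) fun a m _ => ?_
    have h3 := wt_sublist (key a m ((S a).2, false))
    rw [wt_prod]
    have h4 := h2 (m.foldl (fun (z : List RawProcedure × Bool) c => if z.2 then z
      else if RawCond.holds c (s a) then (z.1, true) else (z.1.tail, false)) ((S a).2, false)).2
    dsimp only at h3 ⊢
    omega
  unfold RawSystem.exec
  fun_prop

@[fun_prop]
theorem rawSystem_satisfies {S : α → RawSystem} {R : α → List RawRequirement} (hS : PolyTime S)
    (hR : PolyTime R) : PolyTime fun a => RawSystem.satisfies (S a) (R a) := by
  unfold RawSystem.satisfies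
  fun_prop

end PolyTime

theorem distinct_aux {α : Type} [DecidableEq α] (l : List α) : ∀ s : List α, s.Nodup →
    (l.foldl (fun s p => if memb p s then s else p :: s) s).Nodup ∧
    ∀ x, x ∈ l.foldl (fun s p => if memb p s then s else p :: s) s ↔ x ∈ s ∨ x ∈ l := by
  induction l with
  | nil => intro s hs; simp [hs]
  | cons p l ih =>
    intro s hs
    rw [List.foldl_cons]
    by_cases h : p ∈ s
    · simp only [memb_eq_true.2 h, if_true]
      refine ⟨(ih s hs).1, fun x => ((ih s hs).2 x).trans ?_⟩
      rw [List.mem_cons]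
      constructor
      · tauto
      · rintro (h' | rfl | h') <;> tauto
    · have h' : memb p s = false := by rw [← Bool.not_eq_true, memb_eq_true]; exact h
      simp only [h', Bool.false_eq_true, if_false]
      have hs' : (p :: s).Nodup := List.nodup_cons.2 ⟨h, hs⟩
      refine ⟨(ih _ hs').1, fun x => ((ih _ hs').2 x).trans ?_⟩
      simp only [List.mem_cons]
      tauto

theorem length_distinct {α : Type} [DecidableEq α] (l : List α) :
    (distinct l).length = {p | p ∈ l}.ncard := by
  obtain ⟨h1, h2⟩ : (distinct l).Nodup ∧ ∀ x, x ∈ distinct l ↔ x ∈ [] ∨ x ∈ l :=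
    distinct_aux l [] List.nodup_nil
  have : {p | p ∈ l} = ((distinct l).toFinset : Set α) := by
    ext x
    simpa using (h2 x).symm
  rw [this, Set.ncard_coe_finset, List.toFinset_card_of_nodup h1]

namespace PolyTime

variable {α β : Type} [Code α] [Code β]

@[fun_prop]
theorem distinct [DecidableEq β] [CodeEq β] {l : α → List β} (hl : PolyTime l) :
    PolyTime fun a => distinct (l a) := by
  have h2 : ∀ m s : List β,
      wt (m.foldl (fun s p => if memb p s then s else p :: s) s) + 1 ≤ wt s + wt m := by
    intro m
    induction m with
    | nil => intro s; simp
    | cons p m ih =>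
      intro s
      refine (ih _).trans ?_
      rw [wt_cons]
      dsimp only
      split
      · omega
      · rw [wt_cons]; omega
  refine foldl hl (const []) (by fun_prop) hl.1 fun a m hm => ?_
  have h3 := h2 m []
  have h4 := wt_sublist hm.sublist
  rw [wt_nil] at h3
  omega

@[fun_prop]
theorem rawSystem_typesLe {S : α → RawSystem} {d : α → ℕ} (hS : PolyTime S)
    (hd : PolyTime d) : PolyTime fun a => RawSystem.typesLe (S a) (d a) := by
  unfold RawSystem.typesLe
  fun_prop

@[fun_prop]
theorem rawSystem_distLe {S S' : α → RawSystem} {c : α → ℕ} (hS : PolyTime S)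
    (hS' : PolyTime S') (hc : PolyTime c) :
    PolyTime fun a => RawSystem.distLe (S a) (S' a) (c a) := by
  unfold RawSystem.distLe differences
  fun_prop

end PolyTime

/-! ### Fixed-parameter tractability from polynomial time -/

/-- Types whose weight is the size of the code. -/
class ExactCode (α : Type) [Code α] : Prop where
  wt_eq : ∀ a : α, wt a = (enc a).size

instance : ExactCode Bool := ⟨fun _ => rfl⟩

instance : ExactCode ℕ := ⟨fun _ => rfl⟩

instance {α β : Type} [Code α] [Code β] [ExactCode α] [ExactCode β] : ExactCode (α × β) where
  wt_eq z := by rw [wt_prod, ExactCode.wt_eq, ExactCode.wt_eq]; rfl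

instance {α : Type} [Code α] [ExactCode α] : ExactCode (List α) where
  wt_eq l := by
    induction l with
    | nil => rfl
    | cons a l ih => rw [wt_cons, ih, ExactCode.wt_eq]; rfl

/-- The type `α` with the weight increased by `w`. -/
structure Weighted (α : Type) (w : α → ℕ) where
  val : α

instance {α : Type} [Code α] (w : α → ℕ) : Code (Weighted α w) where
  enc z := enc z.val
  wt z := wt z.val + w z.val
  size_le z := (size_le z.val).trans (Nat.le_add_right _ _)

@[fun_prop]
theorem PolyTime.weighted_val {α β : Type} [Code α] [Code β] {w : β → ℕ} {f : α → Weighted β w}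
    (hf : PolyTime f) : PolyTime fun a => (f a).val :=
  comp (g := Weighted.val) (of_enc (fun _ => rfl) (PolyBdd.self.mono fun _ => Nat.le_add_right _ _))
    hf

/-- After the change of weight, `w` itself counts as polynomially bounded, however fast it grows
with the parameters. -/
theorem polyBdd_weight {α : Type} [Code α] (w : α → ℕ) :
    PolyBdd wt fun z : Weighted α w => w z.val :=
  PolyBdd.self.mono fun _ => Nat.le_add_left _ _

/-- With input size `n ≥ 1` and `w ≤ g`, the time is at most `(n + g + 2) ^ k ≤ (g + 3) ^ k * n ^
k`. -/
theorem ParamProblem.fpTractable_of_polyTime {m : ℕ} {P : ParamProblem m} {α β : Type} [Code α]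
    [Code β] [ExactCode α] {w : α → ℕ} {F : Weighted α w → Option β} (hF : PolyTime F)
    (raw : P.Inst → α) (hraw : ∀ x, enc (raw x) = P.encInst x) (g : (Fin m → ℕ) → ℕ)
    (hg : ∀ x, w (raw x) ≤ g (P.param x))
    (h : ∀ x, ∃ y : Option (P.Sol x), P.IsAnswer x y ∧
      enc (F ⟨raw x⟩) = encOption (P.encSol x) y) : P.FPTractable := by
  obtain ⟨-, T, ⟨k, hk⟩, hp⟩ := hF
  -- Input and output both use register `0`, as `Prog.Computes` demands.
  obtain ⟨p, hp⟩ := hp 1 0 0 Nat.one_pos Nat.one_pos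
  refine ⟨p, fun K => (g K + 3) ^ k, k, fun x => ?_⟩
  obtain ⟨y, hy, hy'⟩ := h x
  obtain ⟨τ, t, ht, hex, hτ, -⟩ := hp ⟨raw x⟩ (initStore (P.encInst x)) (by
    rw [initStore, Function.update_self, ← hraw]; rfl)
  refine ⟨y, t, hy, ⟨τ, hex, hτ.trans hy'⟩, ht.trans ((hk _).trans ?_)⟩
  rw [← mul_pow]
  refine Nat.pow_le_pow_left ?_ k
  have h1 : wt (⟨raw x⟩ : Weighted α w) = (P.encInst x).size + w (raw x) := by
    rw [← hraw, ← ExactCode.wt_eq]; rfl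
  have h2 := (P.encInst x).size_pos
  have h3 := hg x
  rw [h1]
  nlinarith

/-! ### Translation of components and systems -/

theorem encList_map {α β : Type} (e : β → Cell) (f : α → β) (l : List α) :
    encList e (l.map f) = encList (fun a => e (f a)) l := by
  induction l with
  | nil => rfl
  | cons a l ih => simp only [List.map_cons, encList, ih]

section Raw

variable {nI nA : ℕ}

def Cond.raw (c : Cond nI) : RawCond := (c.var, c.positive)

def Procedure.raw (p : Procedure nI nA) : RawProcedure :=
  (p.branches.map fun b => (b.1.raw, (b.2 : ℕ)), p.final)

def System.raw (S : System nI nA) : RawSystem := (S.sel.map Cond.raw, S.prcs.map Procedure.raw)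

def Requirement.raw (r : Requirement nI nA) : RawRequirement := (List.ofFn r.1, r.2)

def Libraries.raw (L : Libraries nI nA) : List (List RawCond) × List RawProcedure :=
  (L.sel.map (List.map Cond.raw), L.prc.map Procedure.raw)

theorem Cond.raw_injective : Function.Injective (Cond.raw (nI := nI)) := by
  rintro ⟨v, b⟩ ⟨v', b'⟩ h
  simpa [Cond.raw, Fin.ext_iff] using h

theorem Procedure.raw_injective : Function.Injective (Procedure.raw (nI := nI) (nA := nA)) := by
  rintro ⟨l, a⟩ ⟨l', a'⟩ h
  have hb : Function.Injective fun b : Cond nI × Fin nA => (b.1.raw, (b.2 : ℕ)) := by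
    rintro ⟨c, a⟩ ⟨c', a'⟩ h
    simp only [Prod.mk.injEq] at h
    rw [Cond.raw_injective h.1, Fin.ext h.2]
  simp only [Procedure.raw, Prod.mk.injEq] at h
  rw [hb.list_map h.1, Fin.ext h.2]

theorem enc_requirements (R : List (Requirement nI nA)) :
    enc (R.map Requirement.raw) = encList encRequirement R :=
  encList_map _ _ _

theorem enc_selector (l : Selector nI) : enc (l.map Cond.raw) = encSelector l :=
  encList_map _ _ _

theorem enc_procedure (p : Procedure nI nA) : enc p.raw = encProcedure p :=
  congrArg (Cell.cons · _) (encList_map _ _ _)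

theorem enc_system (S : System nI nA) : enc S.raw = encSystem S := by
  refine congrArg₂ Cell.cons (enc_selector _) ((encList_map _ _ _).trans ?_)
  simp only [enc_procedure]

theorem enc_libraries (L : Libraries nI nA) : enc L.raw = encLibraries L := by
  refine congrArg₂ Cell.cons ((encList_map _ _ _).trans ?_) ((encList_map _ _ _).trans ?_)
  · simp only [enc_selector]
  · simp only [enc_procedure]

theorem Cond.raw_holds (c : Cond nI) (s : Situation nI) :
    c.raw.holds (List.ofFn s) = c.holds s := by
  rw [Bool.eq_iff_iff, RawCond.holds, memb_eq_true, List.mk_mem_zipIdx_iff_getElem?]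
  simp [Cond.raw, Cond.holds]

theorem Procedure.raw_exec (p : Procedure nI nA) (s : Situation nI) :
    p.raw.exec (List.ofFn s) = p.exec s := by
  obtain ⟨l, a⟩ := p
  simp only [Procedure.raw, Procedure.exec, RawProcedure.exec]
  induction l with
  | nil => rfl
  | cons b l ih =>
    rw [List.map_cons, List.filter_cons, List.find?_cons]
    simp only [Cond.raw_holds]
    cases b.1.holds s with
    | true => rfl
    | false => exact ih

/-- The fold drops as many procedures as there are conditions before the first true one, so the
called procedure is at the head of what remains. -/
theorem System.raw_exec (S : System nI nA) (s : Situation nI) :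
    S.raw.exec (List.ofFn s) = S.exec s := by
  have h1 : ∀ (l : List (Cond nI)) (m : List RawProcedure),
      (l.map Cond.raw).foldl (fun (z : List RawProcedure × Bool) c => if z.2 then z else
        if RawCond.holds c (List.ofFn s) then (z.1, true) else (z.1.tail, false)) (m, true) =
      (m, true) := by
    intro l m
    induction l with
    | nil => rfl
    | cons c l ih => exact ih
  have h2 : ∀ (l : List (Cond nI)) (m : List RawProcedure),
      ((l.map Cond.raw).foldl (fun (z : List RawProcedure × Bool) c => if z.2 then z else
        if RawCond.holds c (List.ofFn s) then (z.1, true) else (z.1.tail, false)) (m, false)).1 =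
      m.drop (l.findIdx fun c => c.holds s) := by
    intro l
    induction l with
    | nil => intro m; rfl
    | cons c l ih =>
      intro m
      simp only [List.map_cons, List.foldl_cons, Bool.false_eq_true, if_false, Cond.raw_holds,
        List.findIdx_cons]
      cases c.holds s with
      | true => simp [h1]
      | false => simp [ih]
  -- There is one more slot than conditions, so the default of `headD` is never used.
  have h3 : S.sel.findIdx (fun c => c.holds s) < S.prcs.length := (S.slot s).2
  rw [RawSystem.exec, System.raw, h2, System.exec, ← Procedure.raw_exec]
  congr 1
  rw [List.headD_eq_head?_getD, List.head?_drop]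
  simp [System.slot, h3]

theorem System.raw_satisfies (S : System nI nA) (R : List (Requirement nI nA)) :
    S.raw.satisfies (R.map Requirement.raw) = true ↔ S.Satisfies R := by
  simp only [RawSystem.satisfies, List.all_eq_true, List.mem_map, decide_eq_true_iff]
  constructor
  · intro h r hr
    exact Fin.ext ((System.raw_exec S r.1).symm.trans (h _ ⟨r, hr, rfl⟩))
  · rintro h _ ⟨r, hr, rfl⟩
    exact (System.raw_exec S r.1).trans (congrArg Fin.val (h r hr))

theorem System.raw_typesLe (S : System nI nA) (d : ℕ) :
    S.raw.typesLe d = true ↔ S.numTypes ≤ d := by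
  have : {p | p ∈ S.raw.2} = Procedure.raw '' {p | p ∈ S.prcs} := by
    ext p
    simp [System.raw]
  rw [RawSystem.typesLe, List.length_cons, length_distinct, this,
    Set.ncard_image_of_injective _ Procedure.raw_injective, System.numTypes]
  simp only [Bool.not_eq_true', decide_eq_false_iff_not]
  omega

/-- The candidates are exactly the untyped copies of the systems drawn from `L`. Hence a successful
search lifts to a typed solution with the same code, and a failed one rules out every solution. -/
theorem exists_answer (L : Libraries nI nA) (ok : RawSystem → Bool) (Q : System nI nA → Prop)
    (h : ∀ S, Q S ↔ S.DrawnFrom L ∧ ok S.raw = true) : ∃ y : Option (System nI nA),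
      (∀ S, y = some S → Q S) ∧ (y = none → ∀ S, ¬ Q S) ∧
      enc ((candidates L.raw.1 L.raw.2).find? ok) = encOption encSystem y := by
  cases hf : (candidates L.raw.1 L.raw.2).find? ok with
  | none =>
    refine ⟨none, by simp, fun _ S hS => ?_, rfl⟩
    obtain ⟨h1, h2⟩ := (h S).1 hS
    refine List.find?_eq_none.1 hf S.raw (mem_candidates.2 ⟨?_, ?_, ?_⟩) h2
    · exact List.mem_map.2 ⟨_, h1.1, rfl⟩
    · simp [S.length_prcs]
    · intro p hp
      obtain ⟨q, hq, rfl⟩ := List.mem_map.1 hp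
      exact List.mem_map.2 ⟨q, h1.2 q hq, rfl⟩
  | some z =>
    obtain ⟨s, t⟩ := z
    obtain ⟨h1, h2, h3⟩ := mem_candidates.1 (List.mem_of_find?_eq_some hf)
    obtain ⟨sel, hsel, rfl⟩ := List.mem_map.1 h1
    -- The tuple is lifted entry by entry to procedures of the library.
    obtain ⟨prcs, hprcs, rfl⟩ : ∃ prcs : List (Procedure nI nA), (∀ p ∈ prcs, p ∈ L.prc) ∧
        prcs.map Procedure.raw = t := by
      clear hf h1 h2
      induction t with
      | nil => exact ⟨[], by simp, rfl⟩
      | cons p t ih =>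
        obtain ⟨q, hq, hqp⟩ := List.mem_map.1 (h3 p (by simp))
        obtain ⟨l, hl, hlt⟩ := ih fun p hp => h3 p (by simp [hp])
        refine ⟨q :: l, ?_, by rw [List.map_cons, hqp, hlt]⟩
        simpa [hq] using hl
    let S : System nI nA := ⟨sel, prcs, by simpa using h2⟩
    refine ⟨some S, fun S' hS' => ?_, by simp, ?_⟩
    · obtain rfl := Option.some.inj hS'
      exact (h S).2 ⟨⟨hsel, hprcs⟩, List.find?_some hf⟩
    · exact congrArg (Cell.cons · .nil) (enc_system S)

end Raw

/-! ### Sequences of component changes -/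

/-- The number of positions in which two lists of the same length differ. -/
noncomputable def hamming {α : Type} (l m : List α) : ℕ := {i : ℕ | l[i]? ≠ m[i]?}.ncard

theorem finite_differing {α : Type} (l m : List α) : {i : ℕ | l[i]? ≠ m[i]?}.Finite := by
  refine (Set.finite_lt_nat (l.length + m.length)).subset fun i hi => ?_
  by_contra h
  simp only [Set.mem_ofPred_eq, not_lt] at h
  exact hi (by rw [List.getElem?_eq_none (by omega), List.getElem?_eq_none (by omega)])

theorem hamming_self {α : Type} (l : List α) : hamming l l = 0 := by simp [hamming]

theorem hamming_set_le {α : Type} (l m : List α) (i : ℕ) (a : α) :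
    hamming l (m.set i a) ≤ hamming l m + 1 := by
  refine (Set.ncard_le_ncard (t := insert i {j : ℕ | l[j]? ≠ m[j]?}) (fun j hj => ?_)
    ((finite_differing l m).insert i)).trans (Set.ncard_insert_le _ _)
  by_cases h : j = i
  · exact Or.inl h
  · right
    rwa [Set.mem_ofPred_eq, List.getElem?_set_ne (Ne.symm h)] at hj

/-- The recorded positions are distinct, so counting entries counts differing positions; injectivity
of `f` means that translation hides no difference. -/
theorem length_differences {α β : Type} [DecidableEq β] {f : α → β} (hf : Function.Injective f)
    {l m : List α} (h : m.length = l.length) :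
    (differences (l.map f) (m.map f)).length = hamming l m := by
  have h1 : ((differences (l.map f) (m.map f)).map Prod.snd).Nodup := by
    refine List.Nodup.sublist (List.filter_sublist.map _) ?_
    rw [List.zipIdx_map_snd]
    exact List.nodup_range'
  rw [hamming, ← List.length_map (f := Prod.snd), ← List.toFinset_card_of_nodup h1,
    ← Set.ncard_coe_finset]
  congr 1
  ext i
  simp only [differences, List.coe_toFinset, List.mem_map, List.mem_filter, Bool.not_eq_true',
    ← Bool.not_eq_true, memb_eq_true, Set.mem_ofPred_eq, Prod.exists,
    List.mk_mem_zipIdx_iff_getElem?, List.getElem?_map, exists_eq_right]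
  constructor
  · rintro ⟨b, h1, h2⟩ h3
    exact h2 (h3 ▸ h1)
  · intro h3
    have hi : i < m.length := by
      by_contra h4
      exact h3 (by rw [List.getElem?_eq_none (by omega), List.getElem?_eq_none (by omega)])
    refine ⟨f m[i], by simp [hi], fun h4 => h3 ?_⟩
    have hi' : i < l.length := by omega
    simp only [List.getElem?_eq_getElem hi', Option.map_some, Option.some.injEq] at h4
    rw [List.getElem?_eq_getElem hi', List.getElem?_eq_getElem hi, hf h4]

section Changes

variable {nI nA : ℕ} {L : Libraries nI nA}

open Classical in
/-- The least number of component changes that lead from `S` to `S'`. -/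
noncomputable def System.dist (S S' : System nI nA) : ℕ :=
  (if S'.sel = S.sel then 0 else 1) + hamming S.prcs S'.prcs

/-- A single change raises the distance from `S` by at most one and preserves the number of slots.
-/
theorem DerivedIn.spec {S S' : System nI nA} {k : ℕ} (h : DerivedIn L S k S')
    (hS : S.DrawnFrom L) :
    S'.DrawnFrom L ∧ S'.prcs.length = S.prcs.length ∧ S.dist S' ≤ k := by
  induction h with
  | refl => exact ⟨hS, rfl, by simp [System.dist, hamming_self]⟩
  | @step k T U _ hc ih =>
    obtain ⟨h1, h2, h3⟩ := ih
    cases hc with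
    | sel hmem hne hlen hprcs =>
      refine ⟨⟨hmem, hprcs ▸ h1.2⟩, hprcs ▸ h2, ?_⟩
      unfold System.dist at h3 ⊢
      rw [hprcs]
      split <;> omega
    | prc i p hp hne hsel hprcs =>
      refine ⟨⟨hsel ▸ h1.1, fun q hq => ?_⟩, by rw [hprcs, List.length_set, h2], ?_⟩
      · rw [hprcs] at hq
        rcases List.mem_or_eq_of_mem_set hq with h | rfl
        · exact h1.2 q h
        · exact hp
      · have := hamming_set_le S.prcs T.prcs i p
        unfold System.dist at h3 ⊢
        rw [hsel, hprcs]
        omega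

/-- Induction on the number of differing slots, working backwards: undoing one difference of `S'`
gives a system one step closer to `S`. -/
theorem derivedIn_of_sel_eq {S : System nI nA} (n : ℕ) : ∀ S' : System nI nA, S'.DrawnFrom L →
    S'.sel = S.sel → hamming S.prcs S'.prcs = n → S.DrawnFrom L → DerivedIn L S n S' := by
  induction n with
  | zero =>
    intro S' _ hsel hh _
    have : S' = S := by
      obtain ⟨s, p, h⟩ := S
      obtain ⟨s', p', h'⟩ := S'
      simp only at hsel hh
      subst hsel
      have : p' = p := by
        refine List.ext_getElem? fun i => ?_
        rw [hamming, Set.ncard_eq_zero (finite_differing _ _)] at hh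
        by_contra h
        have : i ∈ {i | p[i]? ≠ p'[i]?} := Ne.symm h
        rw [hh] at this
        exact this
      subst this
      rfl
    rw [this]
    exact .refl
  | succ n ih =>
    intro S' hS' hsel hh hS
    obtain ⟨i, hi⟩ : {i : ℕ | S.prcs[i]? ≠ S'.prcs[i]?}.Nonempty := by
      rw [← Set.ncard_pos (finite_differing _ _)]
      change 0 < hamming _ _
      omega
    have hlen : S'.prcs.length = S.prcs.length := by
      rw [S.length_prcs, S'.length_prcs, hsel]
    have hi1 : i < S.prcs.length := by
      by_contra h
      exact hi (by rw [List.getElem?_eq_none (by omega), List.getElem?_eq_none (by omega)])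
    have hi2 : i < S'.prcs.length := by omega
    have hne : S.prcs[i] ≠ S'.prcs[i] := fun h => hi (by
      rw [List.getElem?_eq_getElem hi1, List.getElem?_eq_getElem hi2, h])
    -- Slot `i` is reset to its entry in `S`, which lies in the library because `S` is drawn from
    -- it; the last change restores the entry of `S'`.
    let T : System nI nA := ⟨S'.sel, S'.prcs.set i S.prcs[i], by
      rw [List.length_set, S'.length_prcs]⟩
    have hT : hamming S.prcs T.prcs = n := by
      have h1 : {j : ℕ | S.prcs[j]? ≠ T.prcs[j]?} = {j : ℕ | S.prcs[j]? ≠ S'.prcs[j]?} \ {i} := by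
        ext j
        simp only [T, Set.mem_ofPred_eq, Set.mem_sdiff, Set.mem_singleton_iff]
        by_cases hj : j = i
        · subst hj
          simp [hi1, hi2]
        · rw [List.getElem?_set_ne (Ne.symm hj)]
          simp [hj]
      have h2 := Set.ncard_sdiff_singleton_add_one hi (finite_differing _ _)
      rw [← h1] at h2
      change hamming S.prcs T.prcs + 1 = hamming S.prcs S'.prcs at h2
      omega
    refine .step (ih T ⟨hS'.1, fun q hq => ?_⟩ hsel hT hS)
      (.prc ⟨i, by simpa [T] using hi2⟩ S'.prcs[i] (hS'.2 _ (List.getElem_mem _)) ?_ rfl ?_)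
    · rcases List.mem_or_eq_of_mem_set hq with h | rfl
      · exact hS'.2 q h
      · exact hS.2 _ (List.getElem_mem _)
    · simpa [T] using hne.symm
    · simp [T]

/-- The distance is a lower bound for any sequence of changes, and it is attained by changing each
differing slot once and the selector at most once. -/
theorem exists_derivedIn_iff {S S' : System nI nA} (hS : S.DrawnFrom L) (c : ℕ) :
    (∃ k ≤ c, DerivedIn L S k S') ↔
      S'.DrawnFrom L ∧ S'.prcs.length = S.prcs.length ∧ S.dist S' ≤ c := by
  constructor
  · rintro ⟨k, hk, h⟩
    obtain ⟨h1, h2, h3⟩ := h.spec hS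
    exact ⟨h1, h2, h3.trans hk⟩
  · rintro ⟨h1, h2, h3⟩
    refine ⟨_, h3, ?_⟩
    unfold System.dist
    by_cases hsel : S'.sel = S.sel
    · rw [if_pos hsel, Nat.zero_add]
      exact derivedIn_of_sel_eq _ S' h1 hsel rfl hS
    · rw [if_neg hsel, Nat.add_comm]
      have hlen : S'.sel.length = S.sel.length := by
        have := S.length_prcs
        have := S'.length_prcs
        omega
      -- All procedures are changed under the old selector, which is replaced in the last step.
      let T : System nI nA := ⟨S.sel, S'.prcs, by rw [S'.length_prcs, hlen]⟩
      exact .step (derivedIn_of_sel_eq _ T ⟨hS.1, h1.2⟩ rfl rfl hS) (.sel h1.1 hsel hlen rfl)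

theorem System.raw_distLe (S S' : System nI nA) (c : ℕ) :
    S.raw.distLe S'.raw c = true ↔ S'.prcs.length = S.prcs.length ∧ S.dist S' ≤ c := by
  have h1 : S'.raw.2.map (fun _ => true) = S.raw.2.map (fun _ => true) ↔
      S'.prcs.length = S.prcs.length := by
    simp only [List.map_const', System.raw, List.length_map]
    exact ⟨fun h => by simpa using congrArg List.length h, fun h => by rw [h]⟩
  have h2 : S'.raw.1 = S.raw.1 ↔ S'.sel = S.sel := Cond.raw_injective.list_map.eq_iff
  rw [RawSystem.distLe, Bool.and_eq_true, decide_eq_true_iff, h1]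
  refine and_congr_right fun h => ?_
  rw [Bool.not_eq_true', decide_eq_false_iff_not, not_lt, List.length_append]
  have h3 : (differences S.raw.2 S'.raw.2).length = hamming S.prcs S'.prcs :=
    length_differences Procedure.raw_injective h
  rw [h3, System.dist]
  by_cases hs : S'.sel = S.sel
  · simp [hs, h2.2 hs]
  · simp [hs, mt h2.1 hs]

end Changes

/-! ### The two problems -/

theorem maxConds_raw {nI nA : ℕ} (L : Libraries nI nA) :
    (L.raw.1.map List.length).foldr max 0 = L.maxConds := by
  simp only [Libraries.raw, Libraries.maxConds, List.map_map]
  congr 2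
  funext l
  simp

abbrev RawLibraries : Type := List (List RawCond) × List RawProcedure

/-- Bounds the number of fillings of any one selector; this is the extra weight given to an
instance. -/
def RawLibraries.bound (L : RawLibraries) : ℕ :=
  (L.2.length + 1) ^ ((L.1.map List.length).foldr max 0 + 1)

theorem RawLibraries.bound_raw {nI nA : ℕ} (L : Libraries nI nA) :
    RawLibraries.bound L.raw = (L.prc.length + 1) ^ (L.maxConds + 1) := by
  rw [RawLibraries.bound, maxConds_raw]
  simp [Libraries.raw]

abbrev RawCreInstance : Type := ℕ × ℕ × List RawRequirement × RawLibraries × ℕ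

def CreInstance.raw (x : CreInstance) : RawCreInstance :=
  (x.nI, x.nA, x.R.map Requirement.raw, x.L.raw, x.d)

def RawCreInstance.ok (x : RawCreInstance) (S : RawSystem) : Bool :=
  S.typesLe x.2.2.2.2 && S.satisfies x.2.2.1

theorem sCreComp_fpTractable : SCreComp.FPTractable := by
  refine ParamProblem.fpTractable_of_polyTime
    (w := fun x : RawCreInstance => RawLibraries.bound x.2.2.2.1)
    (F := fun x => (candidates x.val.2.2.2.1.1 x.val.2.2.2.1.2).find? x.val.ok) ?_
    CreInstance.raw (fun x => ?_) (fun K => (K 1 + 1) ^ (K 0 + 1)) (fun x => ?_) fun x => ?_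
  · refine PolyTime.list_find? (PolyTime.candidates (by fun_prop) (by fun_prop)
      (polyBdd_weight _)) ?_
    unfold RawCreInstance.ok
    fun_prop
  · exact congrArg (fun c => Cell.cons _ (Cell.cons _ c)) (congrArg₂ Cell.cons
      (enc_requirements x.R) (congrArg (Cell.cons · _) (enc_libraries x.L)))
  · exact (RawLibraries.bound_raw x.L).le
  · obtain ⟨y, h1, h2, h3⟩ := exists_answer x.L x.raw.ok (SCreComp.IsSol x) fun S => by
      change (S.DrawnFrom x.L ∧ S.numTypes ≤ x.d ∧ S.Satisfies x.R) ↔ _ ∧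
        (S.raw.typesLe x.d && S.raw.satisfies (x.R.map Requirement.raw)) = true
      rw [Bool.and_eq_true, System.raw_typesLe, System.raw_satisfies]
    refine ⟨y, ?_, h3⟩
    cases y with
    | none => exact h2 rfl
    | some S => exact h1 S rfl

abbrev RawRecInstance : Type :=
  ℕ × ℕ × List RawRequirement × RawLibraries × RawSystem × List RawRequirement × ℕ × ℕ

def RecInstance.raw (x : RecInstance) : RawRecInstance :=
  (x.nI, x.nA, x.R.map Requirement.raw, x.L.raw, x.S.raw, x.Rnew.map Requirement.raw, x.cl, x.d)

def RawRecInstance.ok (x : RawRecInstance) (S : RawSystem) : Bool :=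
  x.2.2.2.2.1.distLe S x.2.2.2.2.2.2.1 && (S.typesLe x.2.2.2.2.2.2.2 &&
    S.satisfies (x.2.2.1 ++ x.2.2.2.2.2.1))

theorem sRecComp_fpTractable : SRecComp.FPTractable := by
  refine ParamProblem.fpTractable_of_polyTime
    (w := fun x : RawRecInstance => RawLibraries.bound x.2.2.2.1)
    (F := fun x => (candidates x.val.2.2.2.1.1 x.val.2.2.2.1.2).find? x.val.ok) ?_
    RecInstance.raw (fun x => ?_) (fun K => (K 1 + 1) ^ (K 0 + 1)) (fun x => ?_) fun x => ?_
  · refine PolyTime.list_find? (PolyTime.candidates (by fun_prop) (by fun_prop)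
      (polyBdd_weight _)) ?_
    unfold RawRecInstance.ok
    fun_prop
  · exact congrArg (fun c => Cell.cons _ (Cell.cons _ c)) (congrArg₂ Cell.cons
      (enc_requirements x.R) (congrArg₂ Cell.cons (enc_libraries x.L) (congrArg₂ Cell.cons
      (enc_system x.S) (congrArg (Cell.cons · _) (enc_requirements x.Rnew)))))
  · exact (RawLibraries.bound_raw x.L).le
  · obtain ⟨y, h1, h2, h3⟩ := exists_answer x.L x.raw.ok (SRecComp.IsSol x) fun S => by
      change ((∃ k ≤ x.cl, DerivedIn x.L x.S k S) ∧ S.numTypes ≤ x.d ∧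
        S.Satisfies (x.R ++ x.Rnew)) ↔ _ ∧ (x.S.raw.distLe S.raw x.cl && (S.raw.typesLe x.d &&
        S.raw.satisfies (x.R.map Requirement.raw ++ x.Rnew.map Requirement.raw))) = true
      rw [Bool.and_eq_true, Bool.and_eq_true, ← List.map_append, System.raw_typesLe,
        System.raw_satisfies, System.raw_distLe, exists_derivedIn_iff x.drawnFrom, and_assoc]
    refine ⟨y, ?_, h3⟩
    cases y with
    | none => exact h2 rfl
    | some S => exact h1 S rfl

end CompSoft

theorem mainTheorem10 : CompSoft.SCreComp.FPTractable ∧ CompSoft.SRecComp.FPTractable :=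
  ⟨CompSoft.sCreComp_fpTractable, CompSoft.sRecComp_fpTractable⟩
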